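/- \textbf{Setting.} A communication schedule between a finite set $V$ of $n$ nodes, with $k$ messages from $\mathbf F_q^l$ ($l\ge 1$), consists of finitely many events. In a transmission, a node $v$ sends one packet at a time $t$, and this packet arrives at nodes $u^1,\dots,u^b$ ($b\ge 0$) after positive delays; each message is generated at some nodes at some times. The schedule is described by a hypergraph whose vertices are a supersource $s$ and a copy $v_t$ of $v$ for every time $t$ at which $v$ sends, receives or generates a packet. It has a hyperedge $(v_t,\{u^1_{t_1},\dots,u^b_{t_b}\})$ for every transmission and a hyperedge $(s,\{u^1_{t_1},u^2_{t_2},\dots\})$ for every message. For $\mu\in\{0,1,2,\dots\}\cup\{\infty\}$ the information flow graph $G_\mu$ is obtained by giving all these hyperedges capacity $1$ and adding an edge of capacity $\mu$ from each $v_t$ to the next copy of $v$. A hyperedge crosses a cut, and is counted once, if its tail lies on the source side and some head does not. The size of the schedule is the number of vertex copies plus the number of transmissions plus $k$. A protocol with memory $\mu$ lets every node store $\mu$ packets of $\mathbf F_q^l$ (arbitrarily many if $\mu=\infty$). At each of its events a node computes its new memory and the packets it sends, by arbitrary functions, from its memory and the packets arriving at that moment. These functions may be chosen in hindsight, knowing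 the schedule, and may depend on shared randomness. The amount of source information that a protocol delivers to $v_t$ is the mutual information between the messages, taken independent and uniform in $\mathbf F_q^l$, and what $v$ knows at time $t$ (its memory before the event, the packets arriving at the event, and the randomness of the protocol), divided by $\log(q^l)$. The coding protocols send linear combinations of packets $(e_i,s_i)\in\mathbf F_q^{k+l}$, where $s_i$ is the $i$-th message and $e_i$ the $i$-th unit vector; the amount they deliver is measured for given schedule and coefficients, and memory is counted in packets. In PNC a node keeps all packets it has received or generated and sends random linear combinations of them. In the $\mu$-recombinator ($\mu<\infty$) a node stores $\mu$ packets, initially $0$; at each event, its $\mu$ new stored packets and the packets it sends are random linear combinations of its stored packets and the arriving packets. In the $\mu$-accumulator ($\mu<\infty$) a node stores $\mu$ packets, initially $0$; it adds a random multiple of each arriving packet to each stored packet, and sends random linear combinations of its stored packets. All random coefficients are independent and uniform in $\mathbf F_q$. \textbf{Theorem.} Assume that the schedule is fixed or random and that the random coding coefficients are independent of it. For all $c,d\in\mathbf N$ there is a constant $C$, depending only on $c$ and $d$, such that the following holds whenever the schedule almost surely has size at most $n^d$ and $q\ge n^C$. With probability at least $1-n^{-c}$, PNC delivers to $v_t$,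 simultaneously for all vertices $v_t$ of the schedule, exactly the maximum amount of source information that any protocol with memory $\mu=\infty$ could have delivered to $v_t$ on this schedule, and this maximum is the $(s,v_t)$ min-cut in $G_\infty$. For every finite $\mu$ the same holds for the $\mu$-recombinator, with protocols of memory $\mu$ and the graph $G_\mu$, and also for the $\mu$-accumulator if almost surely no node sends at a time at which it also receives or generates a packet. -/

import Mathlib

open MeasureTheory ProbabilityTheory

noncomputable section

/-! ### Communication schedules (time expanded hypergraphs) -/

/-- A finite communication schedule between the nodes `V`, with event times in `T` and `k` messages.
Transmission `e` is made by the node copy `tail e = (v, t)`, i.e. by node `v` at time `t`, and its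
packet reaches the node copies in `recv e` (possibly none), after positive delays.  Message `i` is
generated at the node copies in `gen i`: this is the hyperedge from the supersource. -/
structure Schedule (V T : Type*) [LinearOrder T] (k : ℕ) where
  numTx : ℕ
  tail : Fin numTx → V × T
  recv : Fin numTx → Finset (V × T)
  gen : Fin k → Finset (V × T)
  causal : ∀ e, ∀ y ∈ recv e, (tail e).2 < y.2

namespace Schedule

variable {V T : Type*} [LinearOrder T] {k : ℕ}

/-- Labels of the packets that travel in the schedule: the `k` messages and the transmissions. -/
abbrev Label (S : Schedule V T k) : Type := Fin k ⊕ Fin S.numTx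

/-- The node copies at which a packet arrives (generation of a message counts as an arrival). -/
def heads (S : Schedule V T k) : S.Label → Finset (V × T) :=
  Sum.elim S.gen S.recv

open scoped Classical in
/-- The vertices `v_t` of the time expanded hypergraph: one copy of `v` for every time at which `v`
sends a packet, receives a packet or generates a message. -/
def copies (S : Schedule V T k) : Finset (V × T) :=
  Finset.univ.image S.tail ∪ Finset.univ.biUnion S.heads

/-- The times of all events. -/
def times (S : Schedule V T k) : Finset T :=
  S.copies.image Prod.snd

/-- The number of event times before `t`. -/
def rank (S : Schedule V T k) (t : T) : ℕ :=
  (S.times.filter (· < t)).card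

/-- The size of a schedule: number of node copies, of transmissions and of messages. -/
def size (S : Schedule V T k) : ℕ :=
  S.copies.card + S.numTx + k

/-- At each time, a node either transmits or receives (or generates), but not both. -/
def HalfDuplex (S : Schedule V T k) : Prop :=
  ∀ (e : Fin S.numTx) (p : S.Label), S.tail e ∉ S.heads p

/-- The same events with all times changed by an order preserving map `φ`. -/
def retime (S : Schedule V T k) (φ : T → T) (h : StrictMonoOn φ S.times) : Schedule V T k where
  numTx := S.numTx
  tail := fun e => ((S.tail e).1, φ (S.tail e).2)
  recv := fun e => by
    classical exact (S.recv e).image (fun y => (y.1, φ y.2))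
  gen := fun i => by
    classical exact (S.gen i).image (fun y => (y.1, φ y.2))
  causal := by
    intro e y hy
    classical
    obtain ⟨z, hz, rfl⟩ := Finset.mem_image.1 hy
    refine h ?_ ?_ (S.causal e z hz)
    · refine Finset.mem_coe.2 (Finset.mem_image_of_mem _ ?_)
      exact Finset.mem_union_left _ (Finset.mem_image_of_mem _ (Finset.mem_univ _))
    · refine Finset.mem_coe.2 (Finset.mem_image_of_mem _ ?_)
      exact Finset.mem_union_right _
        (Finset.mem_biUnion.2 ⟨Sum.inr e, Finset.mem_univ _, hz⟩)

/-- The observable events of a random schedule: the sets of schedules that depend on who sends to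
whom and on the order of the events, but not on the numerical values of the times.  (Random schedules
in continuous time are measurable for this small σ-algebra.) -/
instance : MeasurableSpace (Schedule V T k) where
  MeasurableSet' A := ∀ (S : Schedule V T k) (φ : T → T) (h : StrictMonoOn φ S.times),
    S ∈ A ↔ S.retime φ h ∈ A
  measurableSet_empty := fun _ _ _ => Iff.rfl
  measurableSet_compl := fun _ hA S φ h => not_congr (hA S φ h)
  measurableSet_iUnion := fun f hf S φ h => by
    simp only [Set.mem_iUnion]
    exact exists_congr fun i => hf i S φ h

end Schedule

/-! ### Capacitated hypergraphs, min-cuts and the information flow graph -/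

/-- A directed hypergraph with vertices `W`, hyperedges `ι` and capacities. -/
structure FlowHypergraph (W ι : Type*) where
  tail : ι → W
  heads : ι → Finset W
  cap : ι → ℕ∞

open scoped Classical in
/-- The capacity of the cut `(A, Aᶜ)`: a hyperedge crosses if its tail is in `A` and some head is
not; it is counted once. -/
def FlowHypergraph.cutCap {W ι : Type*} [Fintype ι] (H : FlowHypergraph W ι) (A : Set W) : ℕ∞ :=
  ∑ e : ι, if H.tail e ∈ A ∧ ∃ y ∈ H.heads e, y ∉ A then H.cap e else 0

/-- The min-cut between `s` and `x`. -/
def FlowHypergraph.minCut {W ι : Type*} [Fintype ι] (H : FlowHypergraph W ι) (s x : W) : ℕ∞ :=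
  ⨅ (A : Set W) (_ : s ∈ A ∧ x ∉ A), H.cutCap A

namespace Schedule

variable {V T : Type*} [LinearOrder T] {k : ℕ}

open scoped Classical in
/-- The pairs `(v_t, v_t')` of consecutive copies of the same node. -/
def memEdges (S : Schedule V T k) : Finset ((V × T) × (V × T)) :=
  (S.copies ×ˢ S.copies).filter fun p =>
    p.1.1 = p.2.1 ∧ p.1.2 < p.2.2 ∧ ∀ z ∈ S.copies, z.1 = p.1.1 → ¬ (p.1.2 < z.2 ∧ z.2 < p.2.2)

/-- The information flow graph `G_μ`, with supersource `none`: unit capacity hyperedges for the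
messages and the transmissions, memory edges of capacity `μ` between consecutive copies of a node. -/
def infoFlowGraph (S : Schedule V T k) (μ : ℕ∞) :
    FlowHypergraph (Option (V × T)) (S.Label ⊕ {p // p ∈ S.memEdges}) where
  tail := Sum.elim (Sum.elim (fun _ => none) (fun e => some (S.tail e))) (fun p => some p.1.1)
  heads := Sum.elim (fun p => (S.heads p).map Function.Embedding.some) (fun p => {some p.1.2})
  cap := Sum.elim (fun _ => 1) (fun _ => μ)

/-! ### Protocols and their execution -/

/-- A protocol for the schedule `S`.  Every node has a memory with cells `Slot`, each of which holds
one packet.  At a copy `x = (v, t)`, node `v` computes its new memory (`store x`) and the packets it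
sends (`send e`, for the transmissions `e` from `x`) from its memory and the packets that arrive at
`x`, by arbitrary functions. -/
structure Protocol (S : Schedule V T k) (Slot Pkt : Type*) where
  init : V → Slot → Pkt
  store : V × T → (Slot → Pkt) → (S.Label → Option Pkt) → Slot → Pkt
  send : Fin S.numTx → (Slot → Pkt) → (S.Label → Option Pkt) → Pkt

/-- Global state of an execution: memories of all nodes and the packets sent so far. -/
structure State (S : Schedule V T k) (Slot Pkt : Type*) where
  mem : V → Slot → Pkt
  sent : Fin S.numTx → Pkt

variable {Slot Pkt : Type*}

open scoped Classical in
/-- The packets that arrive at the copy `x`, where `orig i` is the packet of message `i`. -/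
def arrivals (S : Schedule V T k) (orig : Fin k → Pkt) (σ : S.State Slot Pkt) (x : V × T) :
    S.Label → Option Pkt :=
  fun p => if x ∈ S.heads p then some (Sum.elim orig σ.sent p) else none

open scoped Classical in
/-- What happens at time `t`. -/
def step (S : Schedule V T k) (A : S.Protocol Slot Pkt) (orig : Fin k → Pkt)
    (σ : S.State Slot Pkt) (t : T) : S.State Slot Pkt where
  mem := fun v =>
    if (v, t) ∈ S.copies then A.store (v, t) (σ.mem v) (S.arrivals orig σ (v, t)) else σ.mem v
  sent := fun e =>
    if (S.tail e).2 = t then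
      A.send e (σ.mem (S.tail e).1) (S.arrivals orig σ (S.tail e))
    else σ.sent e

/-- The state just before time `t`.  (The initial value of `sent` is never read, by causality.) -/
def stateBefore [Nonempty Pkt] (S : Schedule V T k) (A : S.Protocol Slot Pkt) (orig : Fin k → Pkt)
    (t : T) : S.State Slot Pkt :=
  ((S.times.filter (· < t)).sort (· ≤ ·)).foldl (S.step A orig)
    ⟨A.init, fun _ => Classical.arbitrary Pkt⟩

/-- What node `v` knows at the copy `x = (v, t)`: its memory and the packets arriving at `x`. -/
def view [Nonempty Pkt] (S : Schedule V T k) (A : S.Protocol Slot Pkt) (orig : Fin k → Pkt)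
    (x : V × T) : (Slot → Pkt) × (S.Label → Option Pkt) :=
  ((S.stateBefore A orig x.2).mem x.1, S.arrivals orig (S.stateBefore A orig x.2) x)

end Schedule

/-! ### Amount of information -/

open scoped Classical in
/-- The Shannon entropy (in nats) of `X`, as a random variable on the finite set `α` with its uniform
distribution.  As `X` is a function on `α`, it is also the mutual information between the uniform
element of `α` and `X`. -/
def uniformEntropy {α β : Type*} [Fintype α] (X : α → β) : ℝ :=
  ∑ y ∈ Finset.univ.image X,
    Real.negMulLog (((Finset.univ.filter fun a => X a = y).card : ℝ) / (Fintype.card α : ℝ))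

namespace Schedule

variable {V T : Type*} [LinearOrder T] {k : ℕ} {Slot Pkt : Type*}

/-- The amount of source information, in units of one message, that node `v` has at the copy
`x = (v, t)`, for independent uniform messages in `F ^ l`; `enc` turns messages into packets. -/
def info {F : Type*} [Fintype F] {l : ℕ} [Nonempty Pkt] (S : Schedule V T k)
    (A : S.Protocol Slot Pkt) (enc : (Fin k → Fin l → F) → Fin k → Pkt) (x : V × T) : ℝ :=
  uniformEntropy (fun m => S.view A (enc m) x) / Real.log (Fintype.card (Fin l → F))

/-- The amounts of information that protocols with memory `μ` can deliver to the copy `x`.  Packets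
are elements of `F ^ l`, as messages are, and every node stores `μ` of them (countably many if
`μ = ∞`).  Protocols may be chosen in hindsight, knowing all of `S`, and may be randomized: the random
seed `r` has probability `w r` and is known to all nodes, and the amount is then the mutual
information between the messages and what the node knows. -/
def achievable (S : Schedule V T k) (μ : ℕ∞) (F : Type*) [Fintype F] [Nonempty F] (l : ℕ)
    (x : V × T) : Set ℝ :=
  {a | ∃ (R : Type) (_ : Fintype R) (w : R → ℝ)
      (A : R → S.Protocol {i : ℕ // (i : ℕ∞) < μ} (Fin l → F)),
    (∀ r, 0 ≤ w r) ∧ ∑ r, w r = 1 ∧ a = ∑ r, w r * S.info (A r) (fun m => m) x}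

/-- The protocol `A` delivers to every node, at each of its times, exactly the maximum amount of
source information that any protocol with memory `μ` could have delivered, and this is the min-cut
in `G_μ`. -/
def DeliversMax {F : Type*} [Fintype F] [Nonempty F] {l : ℕ} [Nonempty Pkt] (S : Schedule V T k)
    (μ : ℕ∞) (A : S.Protocol Slot Pkt) (enc : (Fin k → Fin l → F) → Fin k → Pkt) : Prop :=
  ∀ x ∈ S.copies, ∃ h : ℕ, (S.infoFlowGraph μ).minCut none (some x) = (h : ℕ∞) ∧
    S.info A enc x = (h : ℝ) ∧ IsGreatest (S.achievable μ F l x) (h : ℝ)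

/-! ### The coding protocols -/

variable {F : Type*} [Field F] {l : ℕ}

/-- The packets of the coding protocols: a coding vector in `F ^ k` and a payload in `F ^ l`. -/
abbrev CodedPkt (F : Type*) (k l : ℕ) : Type _ := (Fin k → F) × (Fin l → F)

/-- Message `s_i` is injected as `(e_i, s_i)`. -/
def withHeader (m : Fin k → Fin l → F) (i : Fin k) : CodedPkt F k l := (Pi.single i 1, m i)

/-- Universal names of packets (message number or transmission number). -/
abbrev PktName (k : ℕ) : Type := Fin k ⊕ ℕ

/-- The universal name of a packet of `S`. -/
def name (S : Schedule V T k) : S.Label → PktName k := Sum.map id Fin.val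

/-- Coefficients of PNC: `(e, p)` is the coefficient of packet `p` in transmission `e`. -/
abbrev PncCoin (k : ℕ) : Type := ℕ × PktName k

/-- PNC: every received packet is kept (in the cell with its label; other cells hold `0`), and a
random combination of all the packets kept is sent. -/
def pnc (S : Schedule V T k) (c : PncCoin k → F) : S.Protocol S.Label (CodedPkt F k l) where
  init := fun _ _ => 0
  store := fun _ mem arr p => (arr p).getD (mem p)
  send := fun e mem arr => ∑ p : S.Label, c (e, S.name p) • (arr p).getD (mem p)

/-- Coefficients of the `μ`-recombinator: the output is the new content of a cell of node `v` at the
`j`-th event time, or a transmission; the input is an old cell content or an arriving packet. -/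
abbrev RecombCoin (V : Type*) (k μ : ℕ) : Type _ :=
  ((V × ℕ × Fin μ) ⊕ ℕ) × (Fin μ ⊕ PktName k)

/-- The `μ`-recombinator: at every event, the `μ` new cell contents and the packets sent are random
combinations of the `μ` stored packets and the arriving packets. -/
def recombinator (S : Schedule V T k) (μ : ℕ) (c : RecombCoin V k μ → F) :
    S.Protocol (Fin μ) (CodedPkt F k l) where
  init := fun _ _ => 0
  store := fun x mem arr i =>
    (∑ j : Fin μ, c (Sum.inl (x.1, S.rank x.2, i), Sum.inl j) • mem j) +
      ∑ p : S.Label, c (Sum.inl (x.1, S.rank x.2, i), Sum.inr (S.name p)) • (arr p).getD 0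
  send := fun e mem arr =>
    (∑ j : Fin μ, c (Sum.inr e, Sum.inl j) • mem j) +
      ∑ p : S.Label, c (Sum.inr e, Sum.inr (S.name p)) • (arr p).getD 0

/-- Coefficients of the `μ`-accumulator: the multiple of an arriving packet that is added to a cell of
node `v` at the `j`-th event time, or the coefficient of a cell in a transmission. -/
abbrev AccCoin (V : Type*) (k μ : ℕ) : Type _ :=
  ((V × ℕ × Fin μ) × PktName k) ⊕ (ℕ × Fin μ)

/-- The `μ`-accumulator: a random multiple of each arriving packet is added to each of the `μ` stored
packets, and random combinations of the stored packets are sent. -/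
def accumulator (S : Schedule V T k) (μ : ℕ) (c : AccCoin V k μ → F) :
    S.Protocol (Fin μ) (CodedPkt F k l) where
  init := fun _ _ => 0
  store := fun x mem arr i =>
    mem i + ∑ p : S.Label, c (Sum.inl ((x.1, S.rank x.2, i), S.name p)) • (arr p).getD 0
  send := fun e mem _ => ∑ j : Fin μ, c (Sum.inr (e, j)) • mem j

/-! ### Non-adaptive random models -/

/-- `G` is a random schedule, the coefficients `Y` are independent and uniform in `F`, and the family
of coefficients is independent of the schedule. -/
structure NonAdaptive {Ω ι : Type*} [MeasurableSpace Ω] [Fintype F] [MeasurableSpace F]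
    (P : Measure Ω) (G : Ω → Schedule V T k) (Y : Ω → ι → F) : Prop where
  measurable_schedule : Measurable G
  measurable_coin : ∀ i, Measurable fun ω => Y ω i
  uniform : ∀ i a, P {ω | Y ω i = a} = (Fintype.card F : ENNReal)⁻¹
  indep : iIndepFun (fun i ω => Y ω i) P
  indep_schedule : IndepFun G Y P

end Schedule

end

noncomputable section

/-! ### Generic linear combinations -/

/-! Upper bound. Fix a cut. What a copy on the sink side knows is a function of the packets and
memory contents that cross the cut, so its entropy is at most the capacity of the cut times the size
of a packet; averaging over the seed covers randomized protocols (`uniformEntropy_view_le`,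
`achievable_le`). With its coefficients fixed, a coding protocol is itself such a protocol, run on
the payloads alone, and it delivers the rank of the known coding vectors (`uniformEntropy_linear`).
So it suffices that every rank reaches the min-cut: rank, maximum and min-cut then coincide.

Lower bound. No flows are constructed. Over an infinite extension field the coefficients can be
chosen once and for all such that an element (a packet or a cell content) lies in a span of earlier
elements only if all its inputs do (`exists_generic_coeffs`). Start from the elements known at a
copy and repeatedly treat the latest one: if it depends on the others, replace it by its inputs,
which does not raise the rank; otherwise move it to a set `C`, which lowers the rank. In the end `C`
is no larger than the initial rank and separates the start from the messages (`exists_separator`).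
The three protocols differ in how `C` is read as a cut of `G_μ` (`exists_pncCoding_rank`,
`exists_recombCoding_rank`, `minCut_le_of_accumulator_separator`).

Transfer to `F`. Coding vectors are polynomials in the coefficients, and a rank attained over the
extension is witnessed by a minor, which is a nonzero polynomial over `F`. The product of these
minors over all copies has degree at most the cube of the size (`Coding.exists_polynomial`), so by
Schwartz–Zippel some rank is too small with probability at most `n ^ (3 * d) / q`.

Random schedules. Only the order of the events matters, so the times may be replaced by their ranks.
This leaves countably many schedules; on each of them the polynomial is fixed, and independence of
the coefficients gives the bound (`NonAdaptive.measure_not_le`). -/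

/-- Over an infinite field, a generic combination `u + ∑ c j • b j` lies in none of finitely many
subspaces, except in those that contain `u` and all `b j`. -/
theorem exists_combination_avoiding {K E I J : Type*} [Field K] [Infinite K] [AddCommGroup E]
    [Module K E] [Finite I] [Fintype J] (W : I → Submodule K E) (u : E) (b : J → E) :
    ∃ c : J → K, ∀ i, u + ∑ j, c j • b j ∈ W i → u ∈ W i ∧ ∀ j, b j ∈ W i := by
  classical
  let L : K × (J → K) →ₗ[K] E :=
    LinearMap.coprod (LinearMap.toSpanSingleton K E u) (Fintype.linearCombination K b)
  have hL : ∀ s c, L (s, c) = s • u + ∑ j, c j • b j := fun s c => by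
    simp [L, Fintype.linearCombination_apply]
  -- The coordinate `s` homogenizes the affine family of combinations. A vector space over an
  -- infinite field is not a finite union of proper subspaces; the hyperplane `s = 0` is included so
  -- that the point found can be scaled to `s = 1`. Preimages that are everything impose nothing and
  -- are replaced by `⊥`.
  let p : Option I → Subspace K (K × (J → K)) := fun o => o.elim
    (LinearMap.ker (LinearMap.fst K K (J → K)))
    (fun i => if (W i).comap L = ⊤ then ⊥ else (W i).comap L)
  have hp : ∀ o, p o ≠ ⊤ := by
    rintro (_ | i) h
    · have : ((1 : K), (0 : J → K)) ∈ p none := h ▸ Submodule.mem_top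
      simp [p] at this
    · by_cases hi : (W i).comap L = ⊤
      · simp only [p, Option.elim, if_pos hi] at h
        exact bot_ne_top h
      · simp only [p, Option.elim, if_neg hi] at h
        exact hi h
  have hU : ⋃ o, (p o : Set (K × (J → K))) ≠ Set.univ := fun h => by
    obtain ⟨o, ho⟩ := Subspace.exists_eq_top_of_iUnion_eq_univ h
    exact hp o ho
  obtain ⟨⟨s, c⟩, hx⟩ := (Set.ne_univ_iff_exists_notMem _).1 hU
  simp only [Set.mem_iUnion, SetLike.mem_coe, not_exists] at hx
  have hs : s ≠ 0 := by simpa [p] using hx none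
  refine ⟨fun j => s⁻¹ * c j, fun i hi => ?_⟩
  have hmem : L (s, c) ∈ W i := by
    have := (W i).smul_mem s hi
    rw [hL]
    simpa [smul_add, Finset.smul_sum, smul_smul, mul_inv_cancel_left₀ hs] using this
  have htop : (W i).comap L = ⊤ := by
    by_contra hne
    have := hx (some i)
    simp only [p, Option.elim, if_neg hne] at this
    exact this hmem
  have hall : ∀ y, L y ∈ W i := fun y => by
    have : y ∈ (W i).comap L := htop ▸ Submodule.mem_top
    exact this
  refine ⟨?_, fun j => ?_⟩
  · simpa [hL] using hall (1, 0)
  · have := hall (0, Pi.single j 1)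
    rw [hL] at this
    simpa [Pi.single_apply, ite_smul] using this

/-- Coefficients of an acyclic linear system can be chosen so that every element is generic over its
inputs, with respect to all spans of earlier elements. -/
theorem exists_generic_coeffs {K E α J : Type*} [Field K] [Infinite K] [AddCommGroup E]
    [Module K E] [Finite α] [Fintype J] (ord : α → ℕ) (src : α → E) (base : α → Option α)
    (inp : α → J → Option α) (hbase : ∀ a b, base a = some b → ord b < ord a)
    (hinp : ∀ a j b, inp a j = some b → ord b < ord a) :
    ∃ (c : α → J → K) (g : α → E), ∀ a,
      g a = src a + (base a).elim 0 g + ∑ j, c a j • (inp a j).elim 0 g ∧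
      ∀ Z : Set α, (∀ b ∈ Z, ord b < ord a) → g a ∈ Submodule.span K (g '' Z) →
        src a + (base a).elim 0 g ∈ Submodule.span K (g '' Z) ∧
        ∀ j, (inp a j).elim 0 g ∈ Submodule.span K (g '' Z) := by
  classical
  -- As `α` is finite, there are finitely many sets `Z`, so one choice of coefficients is generic
  -- for all their spans at once.
  have key := fun (a : α) (p : α → E) => exists_combination_avoiding
    (fun Z : Set α => Submodule.span K (p '' Z)) (src a + (base a).elim 0 p)
    (fun j : J => (inp a j).elim 0 p)
  choose pick hpick using key
  -- Elements not yet constructed count as `0`. This is harmless: `base`, `inp` and the relevant `Z`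
  -- refer to earlier elements only.
  let trunc : (a : α) → ((b : α) → ord b < ord a → E) → α → E :=
    fun a prev b => if h : ord b < ord a then prev b h else 0
  let stepF : (a : α) → ((b : α) → ord b < ord a → E) → E := fun a prev =>
    src a + (base a).elim 0 (trunc a prev) +
      ∑ j, pick a (trunc a prev) j • (inp a j).elim 0 (trunc a prev)
  let g : α → E := (measure ord).wf.fix stepF
  have hg : ∀ a, g a = stepF a (fun b _ => g b) := fun a => (measure ord).wf.fix_eq stepF a
  let p : α → α → E := fun a => trunc a (fun b _ => g b)
  have hp : ∀ a b, ord b < ord a → p a b = g b := fun a b h => by simp [p, trunc, h]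
  have hb : ∀ a, (base a).elim 0 (p a) = (base a).elim 0 g := fun a => by
    cases h : base a with
    | none => rfl
    | some b => exact hp a b (hbase a b h)
  have hi : ∀ a j, (inp a j).elim 0 (p a) = (inp a j).elim 0 g := fun a j => by
    cases h : inp a j with
    | none => rfl
    | some b => exact hp a b (hinp a j b h)
  have hga : ∀ a, g a = src a + (base a).elim 0 g + ∑ j, pick a (p a) j • (inp a j).elim 0 g := by
    intro a
    rw [hg a]
    change src a + (base a).elim 0 (p a) + ∑ j, pick a (p a) j • (inp a j).elim 0 (p a) = _
    simp only [hb, hi]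
  refine ⟨fun a => pick a (p a), g, fun a => ⟨hga a, fun Z hZ hmem => ?_⟩⟩
  have himg : p a '' Z = g '' Z := Set.image_congr fun b hbZ => hp a b (hZ b hbZ)
  have := hpick a (p a) Z
  simp only [hb, hi, himg] at this
  exact this (hga a ▸ hmem)

/-- In a generic acyclic linear system, every set `Z` of elements is separated from the sources by a
set `C` of at most as many elements as the rank of `Z`. -/
theorem exists_separator {K E α : Type*} [Field K] [AddCommGroup E] [Module K E]
    [FiniteDimensional K E] (ord : α → ℕ) (hord : Function.Injective ord) (g : α → E)
    (isSrc : α → Prop) (dep : α → Set α) (hdep : ∀ a, ∀ b ∈ dep a, ord b < ord a)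
    (hsrc : ∀ a, isSrc a → ∀ Z : Set α, (∀ b ∈ Z, ord b < ord a) →
      g a ∉ Submodule.span K (g '' Z))
    (hgen : ∀ a, ∀ Z : Set α, (∀ b ∈ Z, ord b < ord a) →
      g a ∈ Submodule.span K (g '' Z) → ∀ b ∈ dep a, g b ∈ Submodule.span K (g '' Z))
    [Finite α] (Z : Set α) :
    ∃ (U : Set α) (C : Finset α), Z ⊆ U ∧
      C.card ≤ Module.finrank K (Submodule.span K (g '' Z)) ∧
      ∀ a ∈ U, a ∉ C → ¬ isSrc a ∧ dep a ⊆ U := by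
  classical
  -- Induction on a bound for `ord`. By injectivity at most one element of `Z` has order `n`; it is
  -- the latest one and the only one to be treated.
  have main : ∀ (n : ℕ) (Z : Set α), (∀ a ∈ Z, ord a < n) → ∃ (U : Set α) (C : Finset α), Z ⊆ U ∧
      C.card ≤ Module.finrank K (Submodule.span K (g '' Z)) ∧
      ∀ a ∈ U, a ∉ C → ¬ isSrc a ∧ dep a ⊆ U := by
    intro n
    induction n with
    | zero =>
      intro Z hZ
      refine ⟨∅, ∅, fun a ha => absurd (hZ a ha) (Nat.not_lt_zero _), by simp, by simp⟩
    | succ n ih =>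
      intro Z hZ
      by_cases hn : ∃ a ∈ Z, ord a = n
      swap
      · refine ih Z fun a ha => ?_
        have h1 := hZ a ha
        have h2 : ord a ≠ n := fun h => hn ⟨a, ha, h⟩
        omega
      obtain ⟨a, haZ, han⟩ := hn
      have hlt : ∀ b ∈ Z \ {a}, ord b < ord a := by
        rintro b ⟨hbZ, hba⟩
        have h1 := hZ b hbZ
        have h2 : ord b ≠ ord a := fun h => hba (hord h)
        omega
      have hins : insert a (Z \ {a}) = Z := by simp [Set.insert_eq_of_mem haZ]
      -- If `a` depends on the rest, genericity puts its inputs into the span of the rest, so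
      -- trading `a` for them does not increase the rank. Otherwise deleting `a` lowers the rank by
      -- at least one, which pays for putting `a` into `C`.
      by_cases hmem : g a ∈ Submodule.span K (g '' (Z \ {a}))
      · have hns : ¬ isSrc a := fun h => hsrc a h _ hlt hmem
        obtain ⟨U, C, hZU, hC, hU⟩ := ih (Z \ {a} ∪ dep a) (by
          rintro b (hb | hb)
          · exact han ▸ hlt b hb
          · exact han ▸ hdep a b hb)
        refine ⟨insert a U, C, ?_, hC.trans ?_, ?_⟩
        · rw [← hins]
          exact Set.insert_subset_insert (Set.subset_union_left.trans hZU)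
        · refine Submodule.finrank_mono (Submodule.span_le.2 ?_)
          rintro _ ⟨b, hb | hb, rfl⟩
          · exact Submodule.subset_span ⟨b, hb.1, rfl⟩
          · exact Submodule.span_mono (Set.image_mono Set.sdiff_subset) (hgen a _ hlt hmem b hb)
        · rintro b (rfl | hb) hbC
          · exact ⟨hns, (Set.subset_union_right.trans hZU).trans (Set.subset_insert _ _)⟩
          · exact ⟨(hU b hb hbC).1, (hU b hb hbC).2.trans (Set.subset_insert _ _)⟩
      · obtain ⟨U, C, hZU, hC, hU⟩ := ih (Z \ {a}) (fun b hb => han ▸ hlt b hb)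
        refine ⟨insert a U, insert a C, ?_, ?_, ?_⟩
        · rw [← hins]
          exact Set.insert_subset_insert hZU
        · refine (Finset.card_insert_le _ _).trans ?_
          refine (Nat.succ_le_succ hC).trans (Nat.succ_le_of_lt ?_)
          refine Submodule.finrank_lt_finrank_of_lt (lt_of_le_of_ne
            (Submodule.span_mono (Set.image_mono Set.sdiff_subset)) fun h => hmem ?_)
          rw [h]
          exact Submodule.subset_span ⟨a, haZ, rfl⟩
        · intro b hb hbC
          rw [Finset.mem_insert, not_or] at hbC
          rcases hb with rfl | hb
          · exact absurd rfl hbC.1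
          · exact ⟨(hU b hb hbC.2).1, (hU b hb hbC.2).2.trans (Set.subset_insert _ _)⟩
  obtain ⟨N, hN⟩ : ∃ N, ∀ a, ord a < N := by
    obtain ⟨N, hN⟩ := (Set.finite_range ord).bddAbove
    exact ⟨N + 1, fun a => Nat.lt_succ_of_le (hN ⟨a, rfl⟩)⟩
  exact main N Z fun a _ => hN a

/-! ### Ranks of polynomial vectors and the Schwartz–Zippel lemma -/

theorem exists_fun_fin_of_finrank_span_eq {K E : Type*} [Field K] [AddCommGroup E] [Module K E]
    (s : Set E) [FiniteDimensional K (Submodule.span K s)] {h : ℕ}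
    (hh : Module.finrank K (Submodule.span K s) = h) :
    ∃ f : Fin h → E, (∀ i, f i ∈ s) ∧ Submodule.span K (Set.range f) = Submodule.span K s ∧
      LinearIndependent K f := by
  subst hh
  exact Submodule.exists_fun_fin_finrank_span_eq K s

/-- Independent vectors have a nonzero maximal minor. -/
theorem exists_minor_ne_zero {K : Type*} [Field K] {h k : ℕ} (v : Fin h → Fin k → K)
    (hv : LinearIndependent K v) :
    ∃ e : Fin h → Fin k, (Matrix.of fun i j => v i (e j)).det ≠ 0 := by
  classical
  have hr : (Matrix.of v).transpose.rank = h := by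
    rw [Matrix.rank_transpose]
    have := LinearIndependent.rank_matrix (M := Matrix.of v) hv
    simpa using this
  rw [Matrix.rank_eq_finrank_span_cols] at hr
  have hr' : Module.finrank K (Submodule.span K (Set.range fun j : Fin k => fun i => v i j)) = h := by
    have := Matrix.rank_transpose (Matrix.of v)
    rw [Matrix.rank_eq_finrank_span_cols (Matrix.of v)] at this
    rw [Matrix.rank_eq_finrank_span_cols] at this
    rw [hr] at this
    exact this.symm
  obtain ⟨f, hf, -, hli⟩ := exists_fun_fin_of_finrank_span_eq _ hr'
  choose e he using hf
  refine ⟨e, ?_⟩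
  have hcols : (Matrix.of fun i j => v i (e j)).transpose.row = f := by
    funext j i
    exact congrFun (he j) i
  have : IsUnit (Matrix.of fun i j => v i (e j)).transpose := by
    rw [← Matrix.linearIndependent_rows_iff_isUnit, hcols]
    exact hli
  rw [Matrix.isUnit_transpose, Matrix.isUnit_iff_isUnit_det] at this
  exact this.ne_zero

/-- If polynomial vectors have a certain rank at some point over an extension field, then they have
at least this rank outside of the zeros of a nonzero polynomial of bounded degree. -/
theorem exists_polynomial_of_rank {F K ι J : Type*} [Field F] [Field K] [Algebra F K] {k D : ℕ}
    (w : J → Fin k → MvPolynomial ι F) (hw : ∀ j i, (w j i).totalDegree ≤ D) (c₀ : ι → K) :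
    ∃ p : MvPolynomial ι F, p ≠ 0 ∧ p.totalDegree ≤ k * D ∧
      ∀ c : ι → F, MvPolynomial.eval c p ≠ 0 →
        Module.finrank K (Submodule.span K
          (Set.range fun j => fun i => MvPolynomial.aeval c₀ (w j i))) ≤
        Module.finrank F (Submodule.span F
          (Set.range fun j => fun i => MvPolynomial.eval c (w j i))) := by
  classical
  set h := Module.finrank K (Submodule.span K
          (Set.range fun j => fun i => MvPolynomial.aeval c₀ (w j i))) with hh
  have hhk : h ≤ k := (Submodule.finrank_le _).trans (by simp)
  obtain ⟨f, hf, -, hli⟩ := exists_fun_fin_of_finrank_span_eq _ hh.symm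
  choose r hr using hf
  obtain ⟨e, he⟩ := exists_minor_ne_zero f hli
  -- The minor is formed over the polynomial ring: its value at `c₀` shows that it is not the zero
  -- polynomial, and its nonvanishing at a point over `F` certifies `h` independent vectors there.
  set M : Matrix (Fin h) (Fin h) (MvPolynomial ι F) := Matrix.of fun i j => w (r i) (e j) with hM
  have hK : MvPolynomial.aeval c₀ M.det = (Matrix.of fun i j => f i (e j)).det := by
    rw [AlgHom.map_det]
    congr 1
    ext i j
    simp [hM, ← hr]
  refine ⟨M.det, ?_, ?_, ?_⟩
  · intro h0
    rw [h0, map_zero] at hK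
    exact he hK.symm
  · rw [Matrix.det_apply]
    refine MvPolynomial.totalDegree_finsetSum_le fun σ _ => ?_
    refine (MvPolynomial.totalDegree_smul_le _ _).trans ?_
    refine (MvPolynomial.totalDegree_finsetProd _ _).trans ?_
    refine (Finset.sum_le_card_nsmul _ _ D fun i _ => hw _ _).trans ?_
    simpa using Nat.mul_le_mul_right D hhk
  · intro c hc
    have hli' : LinearIndependent F fun i : Fin h => fun j => MvPolynomial.eval c (w (r i) j) := by
      have hd : (M.map (MvPolynomial.eval c)).det ≠ 0 := by
        rwa [RingHom.map_det] at hc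
      have := Matrix.linearIndependent_rows_of_det_ne_zero hd
      exact LinearIndependent.of_comp (LinearMap.funLeft F F e) this
    have := finrank_span_eq_card hli'
    rw [Fintype.card_fin] at this
    rw [← this]
    refine Submodule.finrank_mono (Submodule.span_mono ?_)
    rintro _ ⟨i, rfl⟩
    exact ⟨r i, rfl⟩

theorem MvPolynomial.totalDegree_le_totalDegree_rename {R σ τ : Type*} [CommSemiring R]
    (f : σ → τ) (hf : Function.Injective f) (p : MvPolynomial σ R) :
    p.totalDegree ≤ (MvPolynomial.rename f p).totalDegree := by
  classical
  refine Finset.sup_le fun s hs => ?_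
  have : s.mapDomain f ∈ (MvPolynomial.rename f p).support := by
    rw [MvPolynomial.support_rename_of_injective hf]
    exact Finset.mem_image_of_mem _ hs
  refine le_trans (le_of_eq ?_) (MvPolynomial.le_totalDegree this)
  rw [Finsupp.sum_mapDomain_index (fun _ => rfl) (fun _ _ _ => rfl)]

open scoped Classical in
/-- A nonzero polynomial in independent uniform variables vanishes with probability at most its
degree divided by the size of the field. -/
theorem measure_eval_eq_zero_le {Ω F ι : Type*} [Field F] [Fintype F] [MeasurableSpace F]
    [MeasurableSingletonClass F] [MeasurableSpace Ω] (P : Measure Ω) (Y : Ω → ι → F)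
    (huni : ∀ i a, P {ω | Y ω i = a} = (Fintype.card F : ENNReal)⁻¹)
    (hind : iIndepFun (fun i ω => Y ω i) P) (p : MvPolynomial ι F) (hp : p ≠ 0) :
    P {ω | MvPolynomial.eval (Y ω) p = 0} ≤ (p.totalDegree : ENNReal) / Fintype.card F := by
  -- There may be infinitely many variables, but `p` involves finitely many; Schwartz–Zippel counts
  -- the zeros of `r` among their values, each of which has probability `q ^ (-n)`.
  obtain ⟨n, f, hf, r, rfl⟩ := MvPolynomial.exists_fin_rename p
  have hr : r ≠ 0 := fun h => hp (by simp [h])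
  set q := Fintype.card F with hq
  have hq0 : (q : ENNReal) ≠ 0 := by simp [hq]
  set B : Finset (Fin n → F) := Finset.univ.filter fun y => MvPolynomial.eval y r = 0 with hB
  have hpt : ∀ y : Fin n → F, P {ω | ∀ i, Y ω (f i) = y i} = ((q : ENNReal)⁻¹) ^ n := by
    intro y
    have h := (hind.precomp hf).measure_inter_preimage_eq_mul Finset.univ
      (sets := fun i => {y i}) (fun i _ => measurableSet_singleton _)
    have hset : (⋂ i ∈ (Finset.univ : Finset (Fin n)),
        (fun ω => Y ω (f i)) ⁻¹' ({y i} : Set F)) = {ω | ∀ i, Y ω (f i) = y i} := by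
      ext ω; simp
    have h2 : ∀ i, P ((fun ω => Y ω (f i)) ⁻¹' ({y i} : Set F)) = (q : ENNReal)⁻¹ :=
      fun i => huni (f i) (y i)
    rw [← hset]
    refine h.trans ?_
    rw [Finset.prod_congr rfl fun i _ => h2 i]
    simp
  have hsub : {ω | MvPolynomial.eval (Y ω) (MvPolynomial.rename f r) = 0} ⊆
      ⋃ y ∈ B, {ω | ∀ i, Y ω (f i) = y i} := by
    intro ω hω
    simp only [Set.mem_ofPred_eq, MvPolynomial.eval_rename] at hω
    simp only [Set.mem_iUnion, Set.mem_ofPred_eq, exists_prop]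
    exact ⟨Y ω ∘ f, by simpa [hB] using hω, fun i => rfl⟩
  have hsz := MvPolynomial.schwartz_zippel_totalDegree hr (Finset.univ : Finset F)
  have hcard : (B.card : ℚ≥0) / (q : ℚ≥0) ^ n ≤ (r.totalDegree : ℚ≥0) / q := by
    simpa [hB, hq] using hsz
  have hq1 : (0 : ℚ≥0) < q := by exact_mod_cast Fintype.card_pos
  have hnat : B.card * q ≤ r.totalDegree * q ^ n := by
    rw [div_le_div_iff₀ (by positivity) hq1] at hcard
    exact_mod_cast hcard
  calc P {ω | MvPolynomial.eval (Y ω) (MvPolynomial.rename f r) = 0}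
      ≤ ∑ y ∈ B, P {ω | ∀ i, Y ω (f i) = y i} :=
        (measure_mono hsub).trans (measure_biUnion_finset_le _ _)
    _ = B.card * ((q : ENNReal)⁻¹) ^ n := by simp [hpt]
    _ ≤ (r.totalDegree : ENNReal) / q := by
        rw [ENNReal.le_div_iff_mul_le (Or.inl hq0) (Or.inl (by simp))]
        have h3 : (B.card : ENNReal) * q ≤ r.totalDegree * (q : ENNReal) ^ n := by
          exact_mod_cast hnat
        have hqn : (q : ENNReal) ^ n ≠ 0 := pow_ne_zero _ hq0
        have hqt : (q : ENNReal) ^ n ≠ ⊤ := ENNReal.pow_ne_top (by simp)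
        rw [mul_right_comm, ENNReal.inv_pow.symm, ← div_eq_mul_inv]
        exact ENNReal.div_le_of_le_mul h3
    _ ≤ _ := by
        gcongr
        exact MvPolynomial.totalDegree_le_totalDegree_rename f hf r

/-! ### Entropy -/

/-- Entropy depends only on the partition of `α` into fibres, so variables that determine each other
are interchangeable. -/
theorem uniformEntropy_congr {α β γ : Type*} [Fintype α] (X : α → β) (Y : α → γ)
    (h : ∀ a b, X a = X b ↔ Y a = Y b) : uniformEntropy X = uniformEntropy Y := by
  classical
  unfold uniformEntropy
  refine Finset.sum_bij' (i := fun y hy => Y (Finset.mem_image.1 hy).choose)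
    (j := fun z hz => X (Finset.mem_image.1 hz).choose)
    (fun y hy => Finset.mem_image_of_mem _ (Finset.mem_univ _))
    (fun z hz => Finset.mem_image_of_mem _ (Finset.mem_univ _)) ?_ ?_ ?_
  · intro y hy
    have h1 := (Finset.mem_image.1 hy).choose_spec.2
    conv_rhs => rw [← h1]
    rw [h]
    exact (Finset.mem_image.1 (Finset.mem_image_of_mem Y (Finset.mem_univ
      (Finset.mem_image.1 hy).choose))).choose_spec.2
  · intro z hz
    have h1 := (Finset.mem_image.1 hz).choose_spec.2
    conv_rhs => rw [← h1]
    rw [← h]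
    exact (Finset.mem_image.1 (Finset.mem_image_of_mem X (Finset.mem_univ
      (Finset.mem_image.1 hz).choose))).choose_spec.2
  · intro y hy
    have h1 := (Finset.mem_image.1 hy).choose_spec.2
    have : (Finset.univ.filter fun a => X a = y) = Finset.univ.filter fun a =>
        Y a = Y (Finset.mem_image.1 hy).choose := by
      generalize (Finset.mem_image.1 hy).choose = a₀ at h1
      ext a
      simp only [Finset.mem_filter, Finset.mem_univ, true_and, ← h]
      exact ⟨fun e => e.trans h1.symm, fun e => e.trans h1⟩
    rw [this]

/-- Gibbs' inequality against the uniform law on the `N` values: `log x ≤ x - 1` gives `-p log (p N)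
≤ 1 / N - p`, and these errors sum to zero. -/
theorem uniformEntropy_le_log_card {α β : Type*} [Fintype α] [Nonempty α] [DecidableEq β]
    (X : α → β) : uniformEntropy X ≤ Real.log ((Finset.univ.image X).card : ℝ) := by
  classical
  unfold uniformEntropy
  set N : ℝ := ((Finset.univ.image X).card : ℝ) with hN
  have hα : (0 : ℝ) < Fintype.card α := by exact_mod_cast Fintype.card_pos
  have hNpos : 0 < N := by
    rw [hN]
    exact_mod_cast Finset.card_pos.2 (Finset.univ_nonempty.image X)
  set p : β → ℝ := fun y =>
    ((Finset.univ.filter fun a => X a = y).card : ℝ) / (Fintype.card α : ℝ) with hp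
  have hpos : ∀ y ∈ Finset.univ.image X, 0 < p y := by
    intro y hy
    obtain ⟨a, -, ha⟩ := Finset.mem_image.1 hy
    refine div_pos ?_ hα
    exact_mod_cast Finset.card_pos.2 ⟨a, by simp [ha]⟩
  have hsum : ∑ y ∈ Finset.univ.image X, p y = 1 := by
    rw [hp, ← Finset.sum_div, div_eq_one_iff_eq hα.ne']
    have := Finset.card_eq_sum_card_image X (Finset.univ : Finset α)
    rw [Finset.card_univ] at this
    exact_mod_cast this.symm
  have hterm : ∀ y ∈ Finset.univ.image X,
      Real.negMulLog (p y) ≤ p y * Real.log N + (1 / N - p y) := by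
    intro y hy
    have h1 := hpos y hy
    have h2 : Real.log (1 / (p y * N)) ≤ 1 / (p y * N) - 1 :=
      Real.log_le_sub_one_of_pos (by positivity)
    rw [one_div, Real.log_inv, Real.log_mul h1.ne' hNpos.ne'] at h2
    have h3 := mul_le_mul_of_nonneg_left h2 h1.le
    have h4 : p y * ((p y * N)⁻¹ - 1) = 1 / N - p y := by field_simp
    rw [h4] at h3
    rw [Real.negMulLog]
    linarith
  have hgoal : ∑ y ∈ Finset.univ.image X, Real.negMulLog (p y) ≤ Real.log N := by
    calc _ ≤ ∑ y ∈ Finset.univ.image X, (p y * Real.log N + (1 / N - p y)) :=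
          Finset.sum_le_sum hterm
      _ = Real.log N := by
          rw [Finset.sum_add_distrib, Finset.sum_sub_distrib, ← Finset.sum_mul, hsum]
          rw [Finset.sum_const, nsmul_eq_mul, ← hN]
          field_simp
          ring
  convert hgoal

/-- The entropy of the combinations of the messages with coefficient vectors `g j` is their rank
times the size of a message. -/
theorem uniformEntropy_linear {F J : Type*} [Field F] [Fintype F] {k l : ℕ}
    (g : J → Fin k → F) :
    uniformEntropy (fun (m : Fin k → Fin l → F) (j : J) => ∑ i, g j i • m i) =
      Module.finrank F (Submodule.span F (Set.range g)) *
        Real.log (Fintype.card (Fin l → F)) := by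
  classical
  set X := fun (m : Fin k → Fin l → F) (j : J) => ∑ i, g j i • m i with hX
  set r := Module.finrank F (Submodule.span F (Set.range g)) with hr
  obtain ⟨f, hf, hspan, hli⟩ := exists_fun_fin_of_finrank_span_eq _ hr.symm
  choose e he using hf
  -- the map to the values of a basis of the span
  have hcong : uniformEntropy X =
      uniformEntropy (fun (m : Fin k → Fin l → F) (j : Fin r) => ∑ i, f j i • m i) := by
    refine uniformEntropy_congr _ _ fun a b => ?_
    constructor
    · intro h
      funext j
      have := congrFun h (e j)
      simp only [hX] at this
      simpa only [he] using this
    · intro h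
      funext j
      have hj : g j ∈ Submodule.span F (Set.range f) := by
        rw [hspan]; exact Submodule.subset_span ⟨j, rfl⟩
      simp only [hX]
      generalize g j = y at hj
      induction hj using Submodule.span_induction with
      | mem x hx => obtain ⟨i, rfl⟩ := hx; exact congrFun h i
      | zero => simp
      | add x y _ _ hx hy => simp [add_smul, Finset.sum_add_distrib, hx, hy]
      | smul c x _ hx => simp [mul_smul, ← Finset.smul_sum, hx]
  rw [hcong]
  clear_value r
  -- this map is surjective with fibres of equal size
  let L : (Fin k → Fin l → F) →ₗ[F] (Fin r → Fin l → F) :=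
    { toFun := fun m j => ∑ i, f j i • m i
      map_add' := fun a b => by ext; simp [Finset.sum_add_distrib]
      map_smul' := fun c a => by
        ext; simp [Finset.mul_sum, mul_left_comm] }
  have hsurj : Function.Surjective L := by
    have hcol : ∀ b : Fin r → F, ∃ a : Fin k → F, ∀ j, ∑ i, f j i * a i = b j := by
      have hs : Function.Surjective (Matrix.of f).mulVecLin := by
        rw [← LinearMap.range_eq_top]
        refine Submodule.eq_top_of_finrank_eq ?_
        have h1 := LinearIndependent.rank_matrix (M := Matrix.of f) hli
        rw [Matrix.rank] at h1
        rw [h1]; simp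
      intro b
      obtain ⟨a, ha⟩ := hs b
      exact ⟨a, fun j => congrFun ha j⟩
    intro y
    choose a ha using fun t : Fin l => hcol fun j => y j t
    refine ⟨fun i t => a t i, ?_⟩
    funext j t
    simpa [L] using ha t j
  change uniformEntropy (fun m => L m) = _
  have himg : Finset.univ.image (fun m => L m) = Finset.univ := by
    ext y; simpa using hsurj y
  have hfib : ∀ y, ((Finset.univ.filter fun m => L m = y).card : ℝ) =
      ((Finset.univ.filter fun m => L m = 0).card : ℝ) := by
    intro y
    obtain ⟨m₀, rfl⟩ := hsurj y
    congr 1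
    refine Finset.card_bij' (fun m _ => m - m₀) (fun m _ => m + m₀) ?_ ?_ ?_ ?_ <;>
      simp +contextual
  set Q : ℝ := ((Finset.univ.filter fun m => L m = 0).card : ℝ) with hQ
  have htot : (Fintype.card (Fin r → Fin l → F) : ℝ) * Q =
      Fintype.card (Fin k → Fin l → F) := by
    have := Finset.card_eq_sum_card_image (fun m => L m) Finset.univ
    rw [himg, Finset.card_univ] at this
    have h2 : (Fintype.card (Fin k → Fin l → F) : ℝ) =
      ∑ b, ((Finset.univ.filter fun m => L m = b).card : ℝ) := by exact_mod_cast this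
    rw [h2, Finset.sum_congr rfl fun y _ => hfib y]
    simp
  have hα : (0 : ℝ) < Fintype.card (Fin k → Fin l → F) := by exact_mod_cast Fintype.card_pos
  have hβ : (0 : ℝ) < Fintype.card (Fin r → Fin l → F) := by exact_mod_cast Fintype.card_pos
  have hratio : Q / Fintype.card (Fin k → Fin l → F) =
      (Fintype.card (Fin r → Fin l → F) : ℝ)⁻¹ := by
    rw [div_eq_iff hα.ne', ← htot, inv_mul_cancel_left₀ hβ.ne']
  unfold uniformEntropy
  have hterm : ∀ y, Real.negMulLog (((Finset.univ.filter fun m => L m = y).card : ℝ) /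
      Fintype.card (Fin k → Fin l → F)) = (Fintype.card (Fin r → Fin l → F) : ℝ)⁻¹ *
        Real.log (Fintype.card (Fin r → Fin l → F)) := by
    intro y
    rw [hfib y, hratio, Real.negMulLog, Real.log_inv]
    ring
  have hconv := Finset.sum_congr himg fun y _ => hterm y
  refine Eq.trans (by convert rfl) (hconv.trans ?_)
  rw [Finset.sum_const, nsmul_eq_mul, Finset.card_univ, mul_inv_cancel_left₀ hβ.ne']
  rw [Fintype.card_fun (α := Fin r)]
  simp

namespace Schedule

variable {V T : Type*} [LinearOrder T] {k : ℕ} {Slot Pkt : Type*}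

/-! ### The structure of schedules -/

theorem tail_mem_copies (S : Schedule V T k) (e : Fin S.numTx) : S.tail e ∈ S.copies := by
  classical
  exact Finset.mem_union_left _ (Finset.mem_image_of_mem _ (Finset.mem_univ _))

theorem mem_copies_of_mem_heads (S : Schedule V T k) {p : S.Label} {x : V × T}
    (h : x ∈ S.heads p) : x ∈ S.copies := by
  classical
  exact Finset.mem_union_right _ (Finset.mem_biUnion.2 ⟨p, Finset.mem_univ _, h⟩)

theorem mem_copies_iff (S : Schedule V T k) {x : V × T} :
    x ∈ S.copies ↔ (∃ e, S.tail e = x) ∨ ∃ p, x ∈ S.heads p := by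
  classical
  simp [copies]

theorem snd_mem_times (S : Schedule V T k) {x : V × T} (h : x ∈ S.copies) : x.2 ∈ S.times := by
  classical
  exact Finset.mem_image_of_mem _ h

theorem mem_memEdges (S : Schedule V T k) {y x : V × T} :
    (y, x) ∈ S.memEdges ↔ y ∈ S.copies ∧ x ∈ S.copies ∧ y.1 = x.1 ∧ y.2 < x.2 ∧
      ∀ z ∈ S.copies, z.1 = y.1 → ¬ (y.2 < z.2 ∧ z.2 < x.2) := by
  classical
  simp [memEdges, and_assoc]

theorem memEdges_left_unique (S : Schedule V T k) {y y' x : V × T} (h : (y, x) ∈ S.memEdges)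
    (h' : (y', x) ∈ S.memEdges) : y = y' := by
  rw [mem_memEdges] at h h'
  obtain ⟨hy, -, h1, h2, h3⟩ := h
  obtain ⟨hy', -, h1', h2', h3'⟩ := h'
  refine Prod.ext (h1.trans h1'.symm) (le_antisymm ?_ ?_) <;> by_contra hlt <;>
    rw [not_le] at hlt
  · exact h3' y hy (h1.trans h1'.symm) ⟨hlt, h2⟩
  · exact h3 y' hy' (h1'.trans h1.symm) ⟨hlt, h2'⟩

/-- A copy is the first one of its node, or it has a predecessor. -/
theorem first_or_exists_memEdge (S : Schedule V T k) {x : V × T} (hx : x ∈ S.copies) :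
    (∀ y ∈ S.copies, y.1 = x.1 → ¬ y.2 < x.2) ∨ ∃ y, (y, x) ∈ S.memEdges := by
  classical
  by_cases h : ∃ y ∈ S.copies, y.1 = x.1 ∧ y.2 < x.2
  · right
    obtain ⟨y, hy, hmax⟩ := Finset.exists_max_image
      (S.copies.filter fun y => y.1 = x.1 ∧ y.2 < x.2) Prod.snd
      (by obtain ⟨y, hy⟩ := h; exact ⟨y, Finset.mem_filter.2 hy⟩)
    simp only [Finset.mem_filter] at hy hmax
    refine ⟨y, S.mem_memEdges.2 ⟨hy.1, hx, hy.2.1, hy.2.2, fun z hz hzy hlt => ?_⟩⟩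
    exact (hmax z ⟨hz, hzy.trans hy.2.1, hlt.2⟩).not_gt hlt.1
  · left
    exact fun y hy h1 h2 => h ⟨y, hy, h1, h2⟩

theorem rank_lt_rank (S : Schedule V T k) {s t : T} (hs : s ∈ S.times) (h : s < t) :
    S.rank s < S.rank t := by
  refine Finset.card_lt_card ⟨fun u hu => ?_, fun hsub => ?_⟩
  · rw [Finset.mem_filter] at hu ⊢
    exact ⟨hu.1, hu.2.trans h⟩
  · have := hsub (Finset.mem_filter.2 ⟨hs, h⟩)
    exact lt_irrefl _ (Finset.mem_filter.1 this).2

theorem rank_inj (S : Schedule V T k) {s t : T} (hs : s ∈ S.times) (ht : t ∈ S.times) :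
    S.rank s = S.rank t ↔ s = t := by
  refine ⟨fun h => ?_, fun h => h ▸ rfl⟩
  rcases lt_trichotomy s t with h' | h' | h'
  · exact absurd h (S.rank_lt_rank hs h').ne
  · exact h'
  · exact absurd h (S.rank_lt_rank ht h').ne'

theorem rank_lt_card_copies (S : Schedule V T k) {x : V × T} (hx : x ∈ S.copies) :
    S.rank x.2 < S.copies.card := by
  classical
  refine lt_of_lt_of_le (Finset.card_lt_card (t := S.times) ⟨Finset.filter_subset _ _, fun h => ?_⟩)
    Finset.card_image_le
  exact lt_irrefl _ (Finset.mem_filter.1 (h (S.snd_mem_times hx))).2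

/-! ### The recursion satisfied by an execution -/

section Execution

variable (S : Schedule V T k) (A : S.Protocol Slot Pkt) (orig : Fin k → Pkt)

theorem foldl_step_mem {v : V} (L : List T) (hL : ∀ u ∈ L, (v, u) ∉ S.copies)
    (σ : S.State Slot Pkt) : (L.foldl (S.step A orig) σ).mem v = σ.mem v := by
  induction L generalizing σ with
  | nil => rfl
  | cons u L ih =>
    rw [List.foldl_cons, ih fun u' hu' => hL u' (List.mem_cons_of_mem _ hu')]
    simp [step, hL u List.mem_cons_self]

theorem foldl_step_sent {e : Fin S.numTx} (L : List T) (hL : ∀ u ∈ L, (S.tail e).2 ≠ u)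
    (σ : S.State Slot Pkt) : (L.foldl (S.step A orig) σ).sent e = σ.sent e := by
  induction L generalizing σ with
  | nil => rfl
  | cons u L ih =>
    rw [List.foldl_cons, ih fun u' hu' => hL u' (List.mem_cons_of_mem _ hu')]
    simp [step, hL u List.mem_cons_self]

variable [Nonempty Pkt]

/-- The packets of an execution. -/
def pkt (S : Schedule V T k) (A : S.Protocol Slot Pkt) (orig : Fin k → Pkt) : S.Label → Pkt :=
  Sum.elim orig fun e => A.send e (S.view A orig (S.tail e)).1 (S.view A orig (S.tail e)).2

/-- The sorted times before `t` are those before `s`, then `s`, then those strictly between. The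
execution can thus be resumed at any earlier event; together with the fact that idle times change
nothing, this yields the recursion equations below. -/
theorem stateBefore_split {s t : T} (hs : s ∈ S.times) (hst : s < t) :
    ∃ L : List T, (∀ u ∈ L, u ∈ S.times ∧ s < u ∧ u < t) ∧
      S.stateBefore A orig t = L.foldl (S.step A orig) (S.step A orig (S.stateBefore A orig s) s) := by
  classical
  refine ⟨(S.times.filter fun u => s < u ∧ u < t).sort (· ≤ ·), fun u hu => ?_, ?_⟩
  · simpa using hu
  · have hsort : (S.times.filter (· < t)).sort (· ≤ ·) =
        (S.times.filter (· < s)).sort (· ≤ ·) ++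
          s :: (S.times.filter fun u => s < u ∧ u < t).sort (· ≤ ·) := by
      refine List.Perm.eq_of_pairwise' (r := (· ≤ ·)) (Finset.pairwise_sort _ _) ?_ ?_
      · rw [List.pairwise_append]
        refine ⟨Finset.pairwise_sort _ _, List.pairwise_cons.2
          ⟨fun u hu => ?_, Finset.pairwise_sort _ _⟩, fun a ha b hb => ?_⟩
        · simp only [Finset.mem_sort, Finset.mem_filter] at hu
          exact hu.2.1.le
        · simp only [Finset.mem_sort, Finset.mem_filter, List.mem_cons] at ha hb
          rcases hb with rfl | hb
          · exact ha.2.le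
          · exact (ha.2.trans hb.2.1).le
      · rw [List.perm_ext_iff_of_nodup (Finset.sort_nodup _ _)]
        · intro u
          simp only [Finset.mem_sort, Finset.mem_filter, List.mem_append, List.mem_cons]
          constructor
          · rintro ⟨hu, hut⟩
            rcases lt_trichotomy u s with h | h | h
            · exact Or.inl ⟨hu, h⟩
            · exact Or.inr (Or.inl h)
            · exact Or.inr (Or.inr ⟨hu, h, hut⟩)
          · rintro (⟨hu, h⟩ | rfl | ⟨hu, -, h⟩)
            · exact ⟨hu, h.trans hst⟩
            · exact ⟨hs, hst⟩
            · exact ⟨hu, h⟩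
        · rw [List.nodup_append]
          refine ⟨Finset.sort_nodup _ _, List.nodup_cons.2 ⟨?_, Finset.sort_nodup _ _⟩, ?_⟩
          · simp
          · intro a ha b hb
            simp only [Finset.mem_sort, Finset.mem_filter, List.mem_cons] at ha hb
            rcases hb with rfl | hb
            · exact ha.2.ne
            · exact (ha.2.trans hb.2.1).ne
    unfold stateBefore
    rw [hsort, List.foldl_append, List.foldl_cons]

theorem view_fst_of_memEdge {y x : V × T} (h : (y, x) ∈ S.memEdges) :
    (S.view A orig x).1 = A.store y (S.view A orig y).1 (S.view A orig y).2 := by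
  obtain ⟨hy, -, h1, h2, h3⟩ := S.mem_memEdges.1 h
  obtain ⟨L, hL, hS⟩ := S.stateBefore_split A orig (S.snd_mem_times hy) h2
  simp only [view]
  rw [hS, ← h1, foldl_step_mem]
  · simp [step, hy]
  · intro u hu hc
    exact h3 _ hc rfl (hL u hu).2

theorem view_fst_of_first {x : V × T} (h : ∀ y ∈ S.copies, y.1 = x.1 → ¬ y.2 < x.2) :
    (S.view A orig x).1 = A.init x.1 := by
  simp only [view, stateBefore]
  rw [foldl_step_mem]
  intro u hu hc
  refine h _ hc rfl ?_
  simp only [Finset.mem_sort, Finset.mem_filter] at hu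
  exact hu.2

theorem stateBefore_sent {e : Fin S.numTx} {t : T} (h : (S.tail e).2 < t) :
    (S.stateBefore A orig t).sent e = S.pkt A orig (Sum.inr e) := by
  obtain ⟨L, hL, hS⟩ := S.stateBefore_split A orig (S.snd_mem_times (S.tail_mem_copies e)) h
  rw [hS, foldl_step_sent]
  · simp [step, pkt, view]
  · exact fun u hu => (hL u hu).2.1.ne

-- By causality a packet that arrives was sent strictly earlier, so its entry in `sent` is already
-- final. With the two facts on memories above, this describes executions without reference to the
-- fold.
open scoped Classical in
theorem view_snd (x : V × T) :
    (S.view A orig x).2 = fun p => if x ∈ S.heads p then some (S.pkt A orig p) else none := by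
  funext p
  simp only [view, arrivals]
  split_ifs with h
  · cases p with
    | inl i => rfl
    | inr e => exact congrArg some (S.stateBefore_sent A orig (S.causal e x h))
  · rfl

end Execution

/-- Protocols whose steps agree have the same executions. -/
theorem view_congr [Nonempty Pkt] (S : Schedule V T k) (A B : S.Protocol Slot Pkt)
    (orig : Fin k → Pkt) (hinit : A.init = B.init) (hstep : S.step A orig = S.step B orig)
    (x : V × T) : S.view A orig x = S.view B orig x := by
  simp only [view, stateBefore, hinit, hstep]

/-- Induction along the copies of a schedule. -/
theorem copies_induction (S : Schedule V T k) {motive : V × T → Prop}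
    (h : ∀ x ∈ S.copies, (∀ y ∈ S.copies, y.2 < x.2 → motive y) → motive x) :
    ∀ x ∈ S.copies, motive x := by
  have : ∀ n, ∀ x ∈ S.copies, S.rank x.2 = n → motive x := by
    intro n
    induction n using Nat.strong_induction_on with
    | _ n ih =>
      rintro x hx rfl
      exact h x hx fun y hy hlt => ih _ (S.rank_lt_rank (S.snd_mem_times hy) hlt) y hy rfl
  exact fun x hx => this _ x hx rfl

end Schedule

namespace Schedule

variable {V T : Type*} [LinearOrder T] {k : ℕ} {Slot Pkt : Type*}

/-! ### Simulations -/

/-- A map of packets and memories that commutes with the operations of two protocols commutes with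
their executions. -/
theorem view_map {Slot' Pkt' : Type*} [Nonempty Pkt] [Nonempty Pkt'] (S : Schedule V T k)
    (A : S.Protocol Slot Pkt) (A' : S.Protocol Slot' Pkt') (φ : Pkt → Pkt')
    (ψ : (Slot → Pkt) → Slot' → Pkt') (hinit : ∀ v, A'.init v = ψ (A.init v))
    (hstore : ∀ x m a, A'.store x (ψ m) (fun p => (a p).map φ) = ψ (A.store x m a))
    (hsend : ∀ e m a, A'.send e (ψ m) (fun p => (a p).map φ) = φ (A.send e m a))
    (orig : Fin k → Pkt) :
    ∀ x ∈ S.copies, S.view A' (fun i => φ (orig i)) x =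
      (ψ (S.view A orig x).1, fun p => ((S.view A orig x).2 p).map φ) := by
  classical
  refine S.copies_induction fun x hx ih => Prod.ext ?_ ?_
  · rcases S.first_or_exists_memEdge hx with h | ⟨y, h⟩
    · simp only [S.view_fst_of_first _ _ h, hinit]
    · obtain ⟨hy, -, -, hlt, -⟩ := S.mem_memEdges.1 h
      simp only [S.view_fst_of_memEdge _ _ h, ih y hy hlt, hstore]
  · rw [view_snd]
    funext p
    simp only [view_snd]
    split_ifs with h
    · cases p with
      | inl i => rfl
      | inr e =>
        simp only [pkt, Sum.elim_inr, ih _ (S.tail_mem_copies e) (S.causal e x h), hsend,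
          Option.map_some]
    · rfl

/-! ### Linear protocols -/

/-- Coefficients of a linear protocol: outputs are cells and transmissions, inputs are cells and
arriving packets. -/
structure Coding (S : Schedule V T k) (Slot R : Type*) where
  store : V × T → Slot → Slot ⊕ S.Label → R
  send : Fin S.numTx → Slot ⊕ S.Label → R

namespace Coding

variable {S : Schedule V T k} {R R' M M' : Type*}

/-- All packets known at an event; absent packets count as `0`. -/
def inputs [Zero M] (m : Slot → M) (arr : S.Label → Option M) : Slot ⊕ S.Label → M :=
  Sum.elim m fun p => (arr p).getD 0

theorem inputs_map {F : Type*} [Zero M] [Zero M'] [FunLike F M M'] [ZeroHomClass F M M'] (f : F)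
    (m : Slot → M) (arr : S.Label → Option M) (o : Slot ⊕ S.Label) :
    inputs (fun i => f (m i)) (fun p => (arr p).map f) o = f (inputs m arr o) := by
  cases o with
  | inl i => rfl
  | inr p =>
    simp only [inputs, Sum.elim_inr]
    cases arr p <;> simp

variable [Fintype Slot]

/-- The linear protocol with given coefficients. -/
def protocol [Semiring R] [AddCommMonoid M] [Module R M] (a : S.Coding Slot R) :
    S.Protocol Slot M where
  init := fun _ _ => 0
  store := fun x m arr i => ∑ o, a.store x i o • inputs m arr o
  send := fun e m arr => ∑ o, a.send e o • inputs m arr o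

/-- Change of the ring of coefficients. -/
def map (a : S.Coding Slot R) (f : R → R') : S.Coding Slot R' where
  store := fun x i o => f (a.store x i o)
  send := fun e o => f (a.send e o)

/-- Linear protocols only add and scale, so they commute with semilinear maps of packets. The twist
`σ` covers evaluation of polynomial coefficients; `σ = id` covers the passage from coding vectors to
the packets they stand for. -/
theorem view_protocol_map [Semiring R] [Semiring R'] [AddCommMonoid M] [Module R M]
    [AddCommMonoid M'] [Module R' M'] (a : S.Coding Slot R) (σ : R →+* R') (f : M →ₛₗ[σ] M')
    (orig : Fin k → M) : ∀ x ∈ S.copies,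
      S.view (a.map σ).protocol (fun i => f (orig i)) x =
        (fun i => f ((S.view a.protocol orig x).1 i),
          fun p => ((S.view a.protocol orig x).2 p).map f) := by
  refine S.view_map _ _ f (fun m i => f (m i)) ?_ ?_ ?_ orig
  · intro v; funext i; simp [protocol]
  · intro x m arr
    funext i
    simp only [protocol, map, inputs_map, map_sum, map_smulₛₗ]
  · intro e m arr
    simp only [protocol, map, inputs_map, map_sum, map_smulₛₗ]

/-- The coding vectors of the packets known at a copy. -/
def vec [Semiring R] (a : S.Coding Slot R) (x : V × T) (o : Slot ⊕ S.Label) : Fin k → R :=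
  inputs (S.view (a.protocol (M := Fin k → R)) (fun i => Pi.single i 1) x).1
    (S.view (a.protocol (M := Fin k → R)) (fun i => Pi.single i 1) x).2 o

theorem vec_map [Semiring R] [Semiring R'] (a : S.Coding Slot R) (σ : R →+* R') {x : V × T}
    (hx : x ∈ S.copies) (o : Slot ⊕ S.Label) (i : Fin k) :
    (a.map σ).vec x o i = σ (a.vec x o i) := by
  let f : (Fin k → R) →ₛₗ[σ] (Fin k → R') :=
    { toFun := fun v i => σ (v i)
      map_add' := fun u v => by ext; simp
      map_smul' := fun c v => by ext; simp }
  have h := a.view_protocol_map σ f (fun i => Pi.single i 1) x hx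
  have horig : (fun i : Fin k => f (Pi.single i 1)) = fun i => Pi.single i 1 := by
    funext i j
    simp only [f, LinearMap.coe_mk, AddHom.coe_mk, Pi.single_apply]
    split_ifs <;> simp
  rw [horig] at h
  simp only [vec, h]
  rw [inputs_map]
  rfl

/-- The rank of the packets known at a copy. -/
def rank [Field R] (a : S.Coding Slot R) (x : V × T) : ℕ :=
  Module.finrank R (Submodule.span R (Set.range (a.vec x)))

/-! ### Information delivered by linear protocols -/

/-- Here `f m v` is the packet with coding vector `v` when the messages are `m`. By `hf` it reveals
exactly the combination of the messages given by `v`, so headers, being independent of `m`, add no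
information, and the same argument serves packets with and without header. -/
theorem uniformEntropy_view {F : Type*} [Field F] [Fintype F] {l : ℕ} [AddCommMonoid M]
    [Module F M] (a : S.Coding Slot F) (f : (Fin k → Fin l → F) → (Fin k → F) →ₗ[F] M)
    (hf : ∀ m m' v, f m v = f m' v ↔ ∑ i, v i • m i = ∑ i, v i • m' i) {x : V × T}
    (hx : x ∈ S.copies) :
    uniformEntropy (fun m => S.view a.protocol (fun i => f m (Pi.single i 1)) x) =
      a.rank x * Real.log (Fintype.card (Fin l → F)) := by
  rw [rank, ← uniformEntropy_linear (l := l)]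
  refine uniformEntropy_congr _ _ fun m m' => ?_
  have hm := fun m => a.view_protocol_map (RingHom.id F) (f m) (fun i => Pi.single i 1) x hx
  have hid : a.map (RingHom.id F) = a := rfl
  rw [hid] at hm
  rw [hm, hm, Prod.ext_iff, funext_iff, funext_iff, funext_iff]
  simp only [← hf]
  constructor
  · rintro ⟨h1, h2⟩ (i | p)
    · exact h1 i
    · have := h2 p
      simp only [vec, inputs, Sum.elim_inr]
      revert this
      cases (S.view (a.protocol (M := Fin k → F)) (fun i => Pi.single i 1) x).2 p with
      | none => simp
      | some v => intro h; exact Option.some_injective _ h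
  · intro h
    refine ⟨fun i => h (Sum.inl i), fun p => ?_⟩
    have := h (Sum.inr p)
    simp only [vec, inputs, Sum.elim_inr] at this
    revert this
    cases (S.view (a.protocol (M := Fin k → F)) (fun i => Pi.single i 1) x).2 p with
    | none => simp
    | some v => intro h; exact congrArg some h

theorem log_card_pos (F : Type*) [Field F] [Fintype F] {l : ℕ} (hl : 0 < l) :
    0 < Real.log (Fintype.card (Fin l → F)) := by
  refine Real.log_pos ?_
  have : Nonempty (Fin l) := ⟨⟨0, hl⟩⟩
  exact_mod_cast Fintype.one_lt_card

/-- The linear combination of messages with given coefficients. -/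
def combine {F : Type*} [Field F] {l : ℕ} (m : Fin k → Fin l → F) :
    (Fin k → F) →ₗ[F] (Fin l → F) where
  toFun v := ∑ i, v i • m i
  map_add' u v := by simp [add_smul, Finset.sum_add_distrib]
  map_smul' c v := by simp [mul_smul, Finset.smul_sum]

theorem combine_single {F : Type*} [Field F] {l : ℕ} (m : Fin k → Fin l → F) (i : Fin k) :
    combine m (Pi.single i 1) = m i := by
  simp [combine, Pi.single_apply, ite_smul]

theorem info_withHeader {F : Type*} [Field F] [Fintype F] {l : ℕ} (hl : 0 < l)
    (a : S.Coding Slot F) {x : V × T} (hx : x ∈ S.copies) :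
    S.info (a.protocol (M := CodedPkt F k l)) (withHeader (F := F) (l := l)) x = a.rank x := by
  have h := a.uniformEntropy_view
    (fun m : Fin k → Fin l → F => LinearMap.prod LinearMap.id (combine m)) (fun m m' v => by
      simp [combine]) hx
  have horig : ∀ m : Fin k → Fin l → F, (fun i => (LinearMap.prod LinearMap.id (combine m))
      (Pi.single i 1)) = withHeader m := by
    intro m
    funext i
    simp [withHeader, combine_single]
  simp only [horig] at h
  rw [info, h, mul_div_cancel_right₀ _ (log_card_pos F hl).ne']

theorem info_payload {F : Type*} [Field F] [Fintype F] {l : ℕ} (hl : 0 < l)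
    (a : S.Coding Slot F) {x : V × T} (hx : x ∈ S.copies) :
    S.info (a.protocol (M := Fin l → F)) (fun m : Fin k → Fin l → F => m) x = a.rank x := by
  have h := a.uniformEntropy_view (fun m : Fin k → Fin l → F => combine m) (fun m m' v => by
      simp [combine]) hx
  simp only [combine_single] at h
  rw [info, h, mul_div_cancel_right₀ _ (log_card_pos F hl).ne']

/-- The rank of a linear protocol is achievable by protocols with at least as many memory cells. -/
theorem rank_mem_achievable {F : Type*} [Field F] [Fintype F] {l : ℕ} (hl : 0 < l)
    (a : S.Coding Slot F) (μ : ℕ∞) (j : Slot ↪ {i : ℕ // (i : ℕ∞) < μ}) {x : V × T}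
    (hx : x ∈ S.copies) : (a.rank x : ℝ) ∈ S.achievable μ F l x := by
  classical
  -- In hindsight the coefficients are constants of the protocol, so only payloads need to be stored
  -- and sent. Cells outside the range of `j` stay `0`.
  let ψ : (Slot → Fin l → F) → {i : ℕ // (i : ℕ∞) < μ} → Fin l → F :=
    fun m => Function.extend j m 0
  have hψ : ∀ m, (fun i => ψ m (j i)) = m := fun m => by
    funext i
    exact j.injective.extend_apply _ _ _
  let B : S.Protocol {i : ℕ // (i : ℕ∞) < μ} (Fin l → F) :=
    { init := fun _ _ => 0
      store := fun x m arr => ψ ((a.protocol (M := Fin l → F)).store x (fun i => m (j i)) arr)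
      send := fun e m arr => (a.protocol (M := Fin l → F)).send e (fun i => m (j i)) arr }
  have hview := fun m : Fin k → Fin l → F =>
    S.view_map (a.protocol (M := Fin l → F)) B id ψ (by
      intro v
      funext i
      by_cases hi : ∃ i', j i' = i
      · obtain ⟨i', rfl⟩ := hi
        simp only [ψ, B, protocol, j.injective.extend_apply]
      · simp only [ψ, B, Function.extend_apply' _ _ _ hi, Pi.zero_apply]) (by
      intro x m arr
      simp only [B, hψ, Option.map_id, id]) (by
      intro e m arr
      simp only [B, hψ, Option.map_id, id]) m x hx
  refine ⟨Unit, inferInstance, fun _ => 1, fun _ => B, fun _ => zero_le_one, by simp, ?_⟩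
  rw [Finset.univ_unique, Finset.sum_singleton, one_mul, ← info_payload hl a hx, info, info]
  congr 1
  refine uniformEntropy_congr _ _ fun m m' => ?_
  have h1 := hview m
  have h2 := hview m'
  simp only [id, Option.map_id] at h1 h2
  rw [h1, h2]
  constructor
  · intro h; rw [h]
  · intro h
    rw [Prod.ext_iff] at h ⊢
    refine ⟨?_, h.2⟩
    have := congrArg (fun m i => m (j i)) h.1
    simpa only [hψ] using this

end Coding

/-! ### The cut bound -/

/-- Initial memories do not depend on the messages, so the copies outside `X` learn about them only
through the crossing packets and the crossing memory contents. There are at most `n` of these, hence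
at most `|Pkt| ^ n` different views. -/
theorem uniformEntropy_view_le [Nonempty Pkt] {α : Type*} [Fintype α] [Nonempty α] [Finite Pkt]
    (S : Schedule V T k) (μ : ℕ∞) (A : S.Protocol {i : ℕ // (i : ℕ∞) < μ} Pkt)
    (orig : α → Fin k → Pkt) (X : Set (Option (V × T))) (hs : none ∈ X) {n : ℕ}
    (hn : (S.infoFlowGraph μ).cutCap X ≤ n) {x : V × T} (hxc : x ∈ S.copies) (hx : some x ∉ X) :
    uniformEntropy (fun m => S.view A (orig m) x) ≤ n * Real.log (Nat.card Pkt) := by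
  classical
  -- the crossing labels and memory edges
  let tl : S.Label → Option (V × T) := Sum.elim (fun _ => none) (fun e => some (S.tail e))
  let CP : Finset S.Label := Finset.univ.filter fun p =>
    tl p ∈ X ∧ ∃ y ∈ S.heads p, some y ∉ X
  let CM : Finset {p // p ∈ S.memEdges} := Finset.univ.filter fun p =>
    some p.1.1 ∈ X ∧ some p.1.2 ∉ X
  have hcut : (CP.card : ℕ∞) + CM.card * μ ≤ n := by
    refine le_trans (le_of_eq ?_) hn
    rw [FlowHypergraph.cutCap, Fintype.sum_sum_type]
    congr 1
    · rw [Finset.card_filter, Nat.cast_sum]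
      refine Finset.sum_congr rfl fun p _ => ?_
      simp [infoFlowGraph, tl]
    · rw [Finset.card_filter, Nat.cast_sum, Finset.sum_mul]
      refine Finset.sum_congr rfl fun p _ => ?_
      simp only [infoFlowGraph, Sum.elim_inr, Finset.mem_singleton, exists_eq_left]
      split_ifs <;> simp
  let I := CP ⊕ (CM × {i : ℕ // (i : ℕ∞) < μ})
  have hI : Finite I ∧ Nat.card I ≤ n := by
    -- For unlimited memory, finite capacity of the cut means that no memory edge crosses it, so `I`
    -- is finite although a memory has infinitely many cells.
    by_cases hμ : μ = ⊤
    · have hCM : CM.card = 0 := by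
        by_contra h0
        rw [hμ, ENat.mul_top (by exact_mod_cast h0)] at hcut
        simp at hcut
      have hE : IsEmpty CM := by
        rw [Finset.card_eq_zero] at hCM
        rw [hCM]
        infer_instance
      refine ⟨inferInstance, ?_⟩
      rw [Nat.card_sum]
      rw [hCM] at hcut
      simpa using hcut
    · lift μ to ℕ using hμ
      have eq : {i : ℕ // (i : ℕ∞) < (μ : ℕ∞)} ≃ Fin μ :=
        (Equiv.subtypeEquivRight fun i => by simp).trans Fin.equivSubtype.symm
      have : Finite {i : ℕ // (i : ℕ∞) < (μ : ℕ∞)} := Finite.of_equiv _ eq.symm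
      refine ⟨inferInstance, ?_⟩
      rw [Nat.card_sum, Nat.card_prod, Nat.card_congr eq]
      simp only [Nat.card_eq_fintype_card, Fintype.card_coe, Fintype.card_fin]
      exact_mod_cast hcut
  obtain ⟨hIf, hIc⟩ := hI
  let Φ : α → I → Pkt := fun m => Sum.elim (fun p => S.pkt A (orig m) p.1)
    (fun q => (S.view A (orig m) q.1.1.1.2).1 q.2)
  -- Induction along the copies outside `X`: each input either crosses the cut, and is recorded in
  -- `Φ`, or comes from an earlier copy outside `X`. The content carried by a memory edge is read
  -- off at its head.
  have hdet : ∀ m m', Φ m = Φ m' → ∀ y ∈ S.copies, some y ∉ X →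
      S.view A (orig m) y = S.view A (orig m') y := by
    intro m m' h
    refine S.copies_induction (motive := fun y => some y ∉ X →
      S.view A (orig m) y = S.view A (orig m') y) fun y hy ih hyX => Prod.ext ?_ ?_
    · rcases S.first_or_exists_memEdge hy with h1 | ⟨z, hz⟩
      · simp only [S.view_fst_of_first _ _ h1]
      · obtain ⟨hzc, -, -, hlt, -⟩ := S.mem_memEdges.1 hz
        by_cases hzX : some z ∈ X
        · funext i
          exact congrFun h (Sum.inr (⟨⟨(z, y), hz⟩, by simp [CM, hzX, hyX]⟩, i))
        · simp only [S.view_fst_of_memEdge _ _ hz, ih z hzc hlt hzX]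
    · rw [view_snd, view_snd]
      funext p
      split_ifs with hp
      · congr 1
        by_cases hpX : tl p ∈ X
        · exact congrFun h (Sum.inl ⟨p, by
            simp only [CP, Finset.mem_filter, Finset.mem_univ, true_and]
            exact ⟨hpX, y, hp, hyX⟩⟩)
        · cases p with
          | inl i => exact absurd hs hpX
          | inr e =>
            simp only [pkt, Sum.elim_inr, ih _ (S.tail_mem_copies e) (S.causal e y hp) hpX]
      · rfl
  have hcardle : (Finset.univ.image fun m => S.view A (orig m) x).card ≤ Nat.card Pkt ^ n := by
    have : Fintype I := Fintype.ofFinite I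
    have : Fintype Pkt := Fintype.ofFinite Pkt
    have hex : ∀ y ∈ Finset.univ.image fun m => S.view A (orig m) x,
        ∃ m, S.view A (orig m) x = y := fun y hy => by simpa using hy
    choose! m hm using hex
    calc _ ≤ (Finset.univ : Finset (I → Pkt)).card := by
          refine Finset.card_le_card_of_injOn (fun y => Φ (m y)) (fun _ _ => Finset.mem_univ _) ?_
          intro y hy y' hy' h
          rw [← hm y hy, ← hm y' hy']
          exact hdet _ _ h x hxc hx
      _ = Nat.card Pkt ^ Nat.card I := by
          rw [Finset.card_univ, Fintype.card_fun, Nat.card_eq_fintype_card,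
            Nat.card_eq_fintype_card]
      _ ≤ _ := Nat.pow_le_pow_right Nat.card_pos hIc
  refine (uniformEntropy_le_log_card _).trans ?_
  rw [← Real.log_pow]
  refine Real.log_le_log ?_ (by exact_mod_cast hcardle)
  exact_mod_cast Finset.card_pos.2 (Finset.univ_nonempty.image _)

/-- For each value of the seed the protocol is deterministic and the cut bound applies; the convex
combination inherits it. -/
theorem achievable_le {F : Type*} [Field F] [Fintype F] {l : ℕ} (hl : 0 < l)
    (S : Schedule V T k) (μ : ℕ∞) {x : V × T} (hx : x ∈ S.copies) {h : ℕ}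
    (hh : (S.infoFlowGraph μ).minCut none (some x) = h) {b : ℝ}
    (hb : b ∈ S.achievable μ F l x) : b ≤ h := by
  obtain ⟨X, hX⟩ : ∃ X : Set (Option (V × T)), (none ∈ X ∧ some x ∉ X) ∧
      (S.infoFlowGraph μ).cutCap X ≤ h := by
    have hlt : (S.infoFlowGraph μ).minCut none (some x) < ((h + 1 : ℕ) : ℕ∞) := by
      rw [hh]; exact_mod_cast Nat.lt_succ_self h
    simp only [FlowHypergraph.minCut, iInf_lt_iff] at hlt
    obtain ⟨X, h1, h2⟩ := hlt
    refine ⟨X, h1, ?_⟩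
    rw [Nat.cast_add, Nat.cast_one] at h2
    exact ENat.lt_add_one_iff (by simp) |>.1 h2
  obtain ⟨R, _, w, A, hw0, hw1, rfl⟩ := hb
  have hlog := Coding.log_card_pos F hl
  have hinfo : ∀ r, S.info (A r) (fun m : Fin k → Fin l → F => m) x ≤ h := by
    intro r
    rw [info, div_le_iff₀ hlog]
    have := S.uniformEntropy_view_le μ (A r) (fun m : Fin k → Fin l → F => m) X hX.1.1 hX.2 hx
      hX.1.2
    rwa [Nat.card_eq_fintype_card] at this
  calc _ ≤ ∑ r, w r * h := Finset.sum_le_sum fun r _ => mul_le_mul_of_nonneg_left (hinfo r) (hw0 r)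
    _ = h := by rw [← Finset.sum_mul, hw1, one_mul]

/-- Only the message hyperedges leave the cut `{none}`. This makes the min-cut a natural number even
in `G_∞`. -/
theorem minCut_le_numMessages (S : Schedule V T k) (μ : ℕ∞) (x : V × T) :
    (S.infoFlowGraph μ).minCut none (some x) ≤ k := by
  classical
  refine (iInf₂_le {none} ⟨rfl, by simp⟩).trans ?_
  rw [FlowHypergraph.cutCap, Fintype.sum_sum_type, Fintype.sum_sum_type]
  simp only [infoFlowGraph, Sum.elim_inl, Sum.elim_inr, Set.mem_singleton_iff, reduceCtorEq,
    false_and, if_false, Finset.sum_const_zero, add_zero, true_and]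
  calc _ ≤ ∑ _i : Fin k, (1 : ℕ∞) := Finset.sum_le_sum fun i _ => by split_ifs <;> simp
    _ = k := by simp

/-- A coding protocol whose ranks reach the min-cuts delivers the maximum amount of information. -/
theorem deliversMax_of_minCut_le_rank {F : Type*} [Field F] [Fintype F] {l : ℕ} (hl : 0 < l)
    [Fintype Slot] (S : Schedule V T k) (μ : ℕ∞) (A : S.Protocol Slot (CodedPkt F k l))
    (a : S.Coding Slot F) (hinit : A.init = fun _ _ => 0)
    (hstep : ∀ orig, S.step A orig = S.step a.protocol orig)
    (j : Slot ↪ {i : ℕ // (i : ℕ∞) < μ})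
    (h : ∀ x ∈ S.copies, (S.infoFlowGraph μ).minCut none (some x) ≤ a.rank x) :
    S.DeliversMax μ A (withHeader (F := F) (l := l)) := by
  intro x hx
  obtain ⟨h0, hh0⟩ := ENat.ne_top_iff_exists.1
    (ne_top_of_le_ne_top (ENat.natCast_ne_top k) (S.minCut_le_numMessages μ x))
  have hmem := a.rank_mem_achievable hl μ j hx
  have hle : (a.rank x : ℝ) ≤ h0 := S.achievable_le hl μ hx hh0.symm hmem
  have hge : h0 ≤ a.rank x := by
    have := h x hx
    rw [← hh0] at this
    exact_mod_cast this
  have heq : a.rank x = h0 := le_antisymm (by exact_mod_cast hle) hge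
  refine ⟨h0, hh0.symm, ?_, ?_, fun b hb => S.achievable_le hl μ hx hh0.symm hb⟩
  · rw [← heq, ← a.info_withHeader hl hx, info, info]
    congr 2
    funext m
    exact S.view_congr _ _ _ hinit (hstep _) x
  · rw [← heq]
    exact hmem

end Schedule

/-! ### Generic linear systems with the unit vectors as sources -/

/-- Ties within a level are broken by an enumeration, as in a lexicographic order. The separator
argument needs a strict order because it removes one element at a time, while one event may create
many elements. -/
theorem exists_injective_refinement {α : Type*} [Finite α] (lvl : α → ℕ) :
    ∃ ord : α → ℕ, Function.Injective ord ∧ ∀ a b, lvl a < lvl b → ord a < ord b := by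
  obtain ⟨N, ⟨e⟩⟩ := Finite.exists_equiv_fin α
  refine ⟨fun a => lvl a * N + e a, fun a b h => ?_, fun a b h => ?_⟩
  · have ha := (e a).2
    have hb := (e b).2
    have hl : lvl a = lvl b := by
      rcases lt_trichotomy (lvl a) (lvl b) with h' | h' | h'
      · have := Nat.mul_le_mul_right N (Nat.succ_le_of_lt h')
        rw [Nat.succ_mul] at this
        simp only at h
        omega
      · exact h'
      · have := Nat.mul_le_mul_right N (Nat.succ_le_of_lt h')
        rw [Nat.succ_mul] at this
        simp only at h
        omega
    simp only [hl, Nat.add_left_cancel_iff] at h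
    exact e.injective (Fin.ext h)
  · have ha := (e a).2
    have := Nat.mul_le_mul_right N (Nat.succ_le_of_lt h)
    rw [Nat.succ_mul] at this
    simp only
    omega

/-- An acyclic linear system whose sources are the unit vectors has coefficients for which all ranks
are at least the sizes of separators. -/
theorem exists_generic_system {K α J : Type*} [Field K] [Infinite K] [Finite α] [Fintype J] {k : ℕ}
    (lvl : α → ℕ) (msg : Fin k → α) (hmsg : Function.Injective msg) (base : α → Option α)
    (inp : α → J → Option α) (hlvl : ∀ i, lvl (msg i) = 0)
    (hpos : ∀ a, a ∉ Set.range msg → 0 < lvl a)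
    (hbm : ∀ i, base (msg i) = none) (him : ∀ i j, inp (msg i) j = none)
    (hbase : ∀ a b, base a = some b → lvl b < lvl a)
    (hinp : ∀ a j b, inp a j = some b → lvl b < lvl a) :
    ∃ (c : α → J → K) (g : α → Fin k → K), (∀ i, g (msg i) = Pi.single i 1) ∧
      (∀ a, a ∉ Set.range msg → g a = (base a).elim 0 g + ∑ j, c a j • (inp a j).elim 0 g) ∧
      ∀ Z : Set α, ∃ (U : Set α) (C : Finset α), Z ⊆ U ∧
        C.card ≤ Module.finrank K (Submodule.span K (g '' Z)) ∧
        ∀ a ∈ U, a ∉ C → a ∉ Set.range msg ∧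
          ∀ b, (base a = some b ∨ ∃ j, inp a j = some b) → b ∈ U := by
  classical
  obtain ⟨ord, hord, hlt⟩ := exists_injective_refinement lvl
  let src : α → Fin k → K := fun a => if h : a ∈ Set.range msg then Pi.single h.choose 1 else 0
  have hsm : ∀ i, src (msg i) = Pi.single i 1 := fun i => by
    have h : msg i ∈ Set.range msg := ⟨i, rfl⟩
    simp only [src, dif_pos h, hmsg h.choose_spec]
  have hs0 : ∀ a, a ∉ Set.range msg → src a = 0 := fun a h => dif_neg h
  obtain ⟨c, g, hg⟩ := exists_generic_coeffs (K := K) ord src base inp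
    (fun a b h => hlt _ _ (hbase a b h)) (fun a j b h => hlt _ _ (hinp a j b h))
  have hgm : ∀ i, g (msg i) = Pi.single i 1 := fun i => by
    rw [(hg _).1]
    simp [hbm, him, hsm]
  have hgn : ∀ a, a ∉ Set.range msg →
      g a = (base a).elim 0 g + ∑ j, c a j • (inp a j).elim 0 g := fun a h => by
    rw [(hg _).1, hs0 a h, zero_add]
  refine ⟨c, g, hgm, hgn, fun Z => ?_⟩
  -- All non-messages have positive level, so only other messages precede a message, and their unit
  -- vectors vanish in coordinate `i`.
  have hsrc : ∀ a, a ∈ Set.range msg → ∀ Z : Set α, (∀ b ∈ Z, ord b < ord a) →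
      g a ∉ Submodule.span K (g '' Z) := by
    rintro _ ⟨i, rfl⟩ Z hZ hmem
    have hle : Submodule.span K (g '' Z) ≤
        LinearMap.ker (LinearMap.proj i : (Fin k → K) →ₗ[K] K) := by
      rw [Submodule.span_le]
      rintro _ ⟨b, hb, rfl⟩
      have hb' := hZ b hb
      have hbr : b ∈ Set.range msg := by
        by_contra hbr
        have := hlt (msg i) b (by rw [hlvl]; exact hpos b hbr)
        omega
      obtain ⟨j, rfl⟩ := hbr
      have hij : i ≠ j := by rintro rfl; exact lt_irrefl _ hb'
      simp [hgm, hij]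
    have := hle hmem
    simp [hgm] at this
  refine exists_separator ord hord g (· ∈ Set.range msg)
    (fun a => {b | base a = some b ∨ ∃ j, inp a j = some b}) ?_ hsrc ?_ Z
  · rintro a b (h | ⟨j, h⟩)
    · exact hlt _ _ (hbase a b h)
    · exact hlt _ _ (hinp a j b h)
  · intro a Z hZ hmem b hb
    have ha : a ∉ Set.range msg := fun h => hsrc a h Z hZ hmem
    obtain ⟨h1, h2⟩ := (hg a).2 Z hZ hmem
    rw [hs0 a ha, zero_add] at h1
    rcases hb with h | ⟨j, h⟩
    · simpa [h] using h1
    · simpa [h] using h2 j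

namespace Schedule

variable {V T : Type*} [LinearOrder T] {k : ℕ} {Slot : Type*}

/-! ### Coding vectors and cuts -/

section Recursion

variable {S : Schedule V T k} [Fintype Slot] {R : Type*} [Semiring R] (a : S.Coding Slot R)

theorem Coding.vec_inl_of_first {x : V × T} (h : ∀ y ∈ S.copies, y.1 = x.1 → ¬ y.2 < x.2)
    (j : Slot) : a.vec x (Sum.inl j) = 0 := by
  rw [vec, inputs, Sum.elim_inl, S.view_fst_of_first _ _ h]
  rfl

theorem Coding.vec_inl_of_memEdge {x y : V × T} (h : (y, x) ∈ S.memEdges) (j : Slot) :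
    a.vec x (Sum.inl j) = ∑ o, a.store y j o • a.vec y o := by
  rw [vec, inputs, Sum.elim_inl, S.view_fst_of_memEdge _ _ h]
  rfl

theorem Coding.vec_inr_of_notMem {x : V × T} {p : S.Label} (h : x ∉ S.heads p) :
    a.vec x (Sum.inr p) = 0 := by
  rw [vec, inputs, Sum.elim_inr, view_snd]
  simp [h]

theorem Coding.vec_inr_message {x : V × T} {i : Fin k} (h : x ∈ S.heads (Sum.inl i)) :
    a.vec x (Sum.inr (Sum.inl i)) = Pi.single i 1 := by
  rw [vec, inputs, Sum.elim_inr, view_snd]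
  simp [h, pkt]

theorem Coding.vec_inr_transmission {x : V × T} {e : Fin S.numTx} (h : x ∈ S.heads (Sum.inr e)) :
    a.vec x (Sum.inr (Sum.inr e)) = ∑ o, a.send e o • a.vec (S.tail e) o := by
  rw [vec, inputs, Sum.elim_inr, view_snd]
  simp only [h, if_true, Option.getD_some]
  rfl

/-- The coding vectors are determined by the recursion that they satisfy. -/
theorem Coding.vec_eq_of_recursion (W : V × T → Slot ⊕ S.Label → Fin k → R)
    (hfirst : ∀ x ∈ S.copies, (∀ y ∈ S.copies, y.1 = x.1 → ¬ y.2 < x.2) →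
      ∀ j, W x (Sum.inl j) = 0)
    (hmem : ∀ x y, (y, x) ∈ S.memEdges → ∀ j, W x (Sum.inl j) = ∑ o, a.store y j o • W y o)
    (hno : ∀ x ∈ S.copies, ∀ p, x ∉ S.heads p → W x (Sum.inr p) = 0)
    (hmsg : ∀ x i, x ∈ S.heads (Sum.inl i) → W x (Sum.inr (Sum.inl i)) = Pi.single i 1)
    (htx : ∀ x e, x ∈ S.heads (Sum.inr e) →
      W x (Sum.inr (Sum.inr e)) = ∑ o, a.send e o • W (S.tail e) o) :
    ∀ x ∈ S.copies, a.vec x = W x := by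
  refine S.copies_induction fun x hx ih => ?_
  funext o
  cases o with
  | inl j =>
    rcases S.first_or_exists_memEdge hx with h | ⟨y, h⟩
    · rw [hfirst x hx h, a.vec_inl_of_first h]
    · obtain ⟨hy, -, -, hlt, -⟩ := S.mem_memEdges.1 h
      rw [hmem x y h, ← ih y hy hlt, a.vec_inl_of_memEdge h]
  | inr p =>
    by_cases h : x ∈ S.heads p
    · cases p with
      | inl i => rw [hmsg x i h, a.vec_inr_message h]
      | inr e =>
        rw [htx x e h, ← ih _ (S.tail_mem_copies e) (S.causal e x h), a.vec_inr_transmission h]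
    · rw [hno x hx p h, a.vec_inr_of_notMem h]

end Recursion

theorem Coding.finrank_le_rank {S : Schedule V T k} [Fintype Slot] {R : Type*} [Field R]
    (a : S.Coding Slot R) {x : V × T} (s : Set (Fin k → R)) (h : s ⊆ Set.range (a.vec x)) :
    Module.finrank R (Submodule.span R s) ≤ a.rank x :=
  Submodule.finrank_mono (Submodule.span_mono h)

open scoped Classical in
/-- The labels that cross the cut with sink side `W`. -/
def crossingLabels (S : Schedule V T k) (W : Set (V × T)) : Finset S.Label :=
  Finset.univ.filter fun p => (∀ e, p = Sum.inr e → S.tail e ∉ W) ∧ ∃ y ∈ S.heads p, y ∈ W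

open scoped Classical in
/-- The memory edges that cross the cut with sink side `W`. -/
def crossingMemEdges (S : Schedule V T k) (W : Set (V × T)) : Finset ((V × T) × (V × T)) :=
  S.memEdges.filter fun p => p.1 ∉ W ∧ p.2 ∈ W

/-- A separator is closed under taking inputs, which makes the sink side `W` the natural description
of a cut. All remaining copies and the supersource form the source side. -/
theorem minCut_le (S : Schedule V T k) (μ : ℕ∞) (W : Set (V × T)) {x : V × T} (hx : x ∈ W) :
    (S.infoFlowGraph μ).minCut none (some x) ≤
      (S.crossingLabels W).card + (S.crossingMemEdges W).card * μ := by
  classical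
  let X : Set (Option (V × T)) := {o | ∀ y, o = some y → y ∉ W}
  have hX : ∀ y, some y ∈ X ↔ y ∉ W := fun y =>
    ⟨fun h => h y rfl, fun h z hz => Option.some_injective _ hz ▸ h⟩
  have hn : none ∈ X := by simp [X]
  refine (iInf₂_le X ⟨hn, fun h => (hX x).1 h hx⟩).trans (le_of_eq ?_)
  rw [FlowHypergraph.cutCap, Fintype.sum_sum_type]
  congr 1
  · rw [crossingLabels, Finset.card_filter, Nat.cast_sum]
    refine Finset.sum_congr rfl fun p _ => ?_
    cases p <;> simp [infoFlowGraph, hX, hn]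
  · rw [crossingMemEdges, Finset.card_filter, Nat.cast_sum, Finset.sum_mul,
      ← Finset.sum_coe_sort S.memEdges]
    refine Finset.sum_congr rfl fun p _ => ?_
    simp only [infoFlowGraph, Sum.elim_inr, Finset.mem_singleton, exists_eq_left, hX, not_not]
    split_ifs <;> simp

theorem memEdges_right_unique (S : Schedule V T k) {z y y' : V × T} (h : (z, y) ∈ S.memEdges)
    (h' : (z, y') ∈ S.memEdges) : y = y' := by
  have h1 := S.mem_memEdges.1 h
  have h2 := S.mem_memEdges.1 h'
  refine Prod.ext (h1.2.2.1.symm.trans h2.2.2.1) (le_antisymm ?_ ?_) <;>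
    refine not_lt.1 fun hlt => ?_
  · exact h1.2.2.2.2 y' h2.2.1 h2.2.2.1.symm ⟨h2.2.2.2.1, hlt⟩
  · exact h2.2.2.2.2 y h1.2.1 h1.2.2.1.symm ⟨h1.2.2.2.1, hlt⟩

open scoped Classical in
/-- The previous copy of the same node. -/
def prev (S : Schedule V T k) (x : V × T) : Option {y // y ∈ S.copies} :=
  if h : ∃ y, (y, x) ∈ S.memEdges then
    some ⟨h.choose, (S.mem_memEdges.1 h.choose_spec).1⟩
  else none

theorem prev_eq_some_iff (S : Schedule V T k) {x : V × T} {y : {y // y ∈ S.copies}} :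
    S.prev x = some y ↔ (y.1, x) ∈ S.memEdges := by
  unfold prev
  split_ifs with h
  · simp only [Option.some.injEq]
    constructor
    · rintro rfl
      exact h.choose_spec
    · exact fun hy => Subtype.ext (S.memEdges_left_unique h.choose_spec hy)
  · simpa using fun hy => h ⟨y, hy⟩

/-! ### Packets and cells of protocols with `μ` cells -/

/-- The packets and cell contents of an execution of a protocol with `μ` cells. -/
abbrev Element (S : Schedule V T k) (μ : ℕ) : Type _ := S.Label ⊕ ({y // y ∈ S.copies} × Fin μ)

open scoped Classical in
/-- The packets known at the copy `x`. -/
def known (S : Schedule V T k) (μ : ℕ) (x : V × T) : Fin μ ⊕ S.Label → Option (S.Element μ) :=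
  Sum.elim (fun j => (S.prev x).map fun y => Sum.inr (y, j))
    (fun p => if x ∈ S.heads p then some (Sum.inl p) else none)

/-- The number of events up to the creation of a packet or cell content. -/
def level (S : Schedule V T k) (μ : ℕ) : S.Element μ → ℕ :=
  Sum.elim (Sum.elim (fun _ => 0) fun e => S.rank (S.tail e).2 + 1) fun q => S.rank q.1.1.2 + 1

/-- The bound `S.rank x.2 + 1` is the level of whatever is produced at `x`; so this is the
acyclicity of the linear systems below. -/
theorem level_lt_of_known (S : Schedule V T k) (μ : ℕ) {x : V × T} {o : Fin μ ⊕ S.Label}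
    {b : S.Element μ} (h : S.known μ x o = some b) : S.level μ b < S.rank x.2 + 1 := by
  cases o with
  | inl j =>
    simp only [known, Sum.elim_inl, Option.map_eq_some_iff] at h
    obtain ⟨y, hy, rfl⟩ := h
    rw [prev_eq_some_iff, mem_memEdges] at hy
    exact Nat.succ_lt_succ (S.rank_lt_rank (S.snd_mem_times hy.1) hy.2.2.2.1)
  | inr p =>
    simp only [known, Sum.elim_inr] at h
    split_ifs at h with hp
    obtain rfl := Option.some_injective _ h
    cases p with
    | inl i => simp [level]
    | inr e =>
      exact Nat.succ_lt_succ (S.rank_lt_rank (S.snd_mem_times (S.tail_mem_copies e))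
        (S.causal e x hp))

theorem known_inl_eq_some (S : Schedule V T k) (μ : ℕ) {x y : V × T} (h : (y, x) ∈ S.memEdges)
    (j : Fin μ) : S.known μ x (Sum.inl j) =
      some (Sum.inr (⟨y, (S.mem_memEdges.1 h).1⟩, j)) := by
  have := S.prev_eq_some_iff.2 (show ((⟨y, (S.mem_memEdges.1 h).1⟩ : {y // y ∈ S.copies}).1, x) ∈
    S.memEdges from h)
  simp [known, this]

theorem known_inl_eq_none (S : Schedule V T k) (μ : ℕ) {x : V × T}
    (h : ∀ y ∈ S.copies, y.1 = x.1 → ¬ y.2 < x.2) (j : Fin μ) :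
    S.known μ x (Sum.inl j) = none := by
  rw [known, Sum.elim_inl, Option.map_eq_none_iff, Option.eq_none_iff_forall_ne_some]
  intro y hy
  rw [prev_eq_some_iff, mem_memEdges] at hy
  exact h _ hy.1 hy.2.2.1 hy.2.2.2.1

theorem known_inr (S : Schedule V T k) (μ : ℕ) {x : V × T} {p : S.Label} (h : x ∈ S.heads p) :
    S.known μ x (Sum.inr p) = some (Sum.inl p) := by
  simp [known, h]

/-- A separator yields a cut if the crossing labels lie in it and each crossing memory edge can be
charged to `μ` cell contents in it. -/
theorem minCut_le_card (S : Schedule V T k) (μ : ℕ) (W : Set (V × T)) {x : V × T} (hx : x ∈ W)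
    (C : Finset (S.Element μ)) (hL : ∀ p ∈ S.crossingLabels W, Sum.inl p ∈ C)
    (cell : (V × T) × (V × T) → Fin μ → {y // y ∈ S.copies})
    (hM : ∀ q ∈ S.crossingMemEdges W, ∀ j, Sum.inr (cell q j, j) ∈ C)
    (hinj : ∀ q ∈ S.crossingMemEdges W, ∀ q' ∈ S.crossingMemEdges W, ∀ j,
      cell q j = cell q' j → q = q') :
    (S.infoFlowGraph μ).minCut none (some x) ≤ C.card := by
  classical
  refine (S.minCut_le μ W hx).trans ?_
  -- A crossing memory edge has capacity `μ`, so it is charged once for every cell index.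
  have h : ((S.crossingLabels W).disjSum (S.crossingMemEdges W ×ˢ (Finset.univ : Finset (Fin μ)))).card
      ≤ C.card := by
    refine Finset.card_le_card_of_injOn
      (Sum.map id (fun q : ((V × T) × (V × T)) × Fin μ => (cell q.1 q.2, q.2))) ?_ ?_
    · rintro (p | q) h
      · exact hL p (by simpa using h)
      · exact hM q.1 (by simpa using h) q.2
    · rintro (p | ⟨q, j⟩) h (p' | ⟨q', j'⟩) h' heq
      · simpa using heq
      · simp at heq
      · simp at heq
      · simp only [Sum.map_inr, Sum.inr.injEq,
          Prod.mk.injEq] at heq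
        obtain ⟨h1, rfl⟩ := heq
        rw [hinj q (by simpa using h) q' (by simpa using h') j h1]
  rw [Finset.card_disjSum, Finset.card_product, Finset.card_univ, Fintype.card_fin] at h
  exact_mod_cast h

/-! ### The recombinator -/

theorem name_injective (S : Schedule V T k) : Function.Injective S.name :=
  Sum.map_injective.2 ⟨Function.injective_id, Fin.val_injective⟩

/-- The linear protocol underlying the recombinator. -/
def recombCoding {R : Type*} (S : Schedule V T k) (μ : ℕ) (c : RecombCoin V k μ → R) :
    S.Coding (Fin μ) R where
  store := fun x i o => c (Sum.inl (x.1, S.rank x.2, i), o.map id S.name)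
  send := fun e o => c (Sum.inr e, o.map id S.name)

/-- Every cell content and transmission produced at `z` combines everything known at `z`. If one of
them is in `U` but not in `C`, then all that is known at `z` is in `U`. So whatever `U` receives
from a copy that does not have this property is in `C`. -/
theorem exists_recombCoding_rank {K : Type*} [Field K] [Infinite K] (S : Schedule V T k) (μ : ℕ) :
    ∃ c : RecombCoin V k μ → K, ∀ x ∈ S.copies,
      (S.infoFlowGraph μ).minCut none (some x) ≤ (S.recombCoding μ c).rank x := by
  classical
  let inp : S.Element μ → Fin μ ⊕ S.Label → Option (S.Element μ) :=
    Sum.elim (Sum.elim (fun _ _ => none) fun e => S.known μ (S.tail e)) fun q => S.known μ q.1.1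
  have hnm : ∀ a : S.Element μ, a ∉ Set.range (fun i : Fin k => Sum.inl (Sum.inl i)) →
      0 < S.level μ a := by
    rintro ((i | e) | q) h
    · exact absurd ⟨i, rfl⟩ h
    · exact Nat.succ_pos _
    · exact Nat.succ_pos _
  obtain ⟨c, g, hgm, hgn, hsep⟩ := exists_generic_system (K := K) (S.level μ)
    (fun i : Fin k => Sum.inl (Sum.inl i))
    (Sum.inl_injective.comp Sum.inl_injective) (fun _ => none) inp (fun _ => rfl) hnm
    (fun _ => rfl) (fun _ _ => rfl) (fun _ _ h => by simp at h) (by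
      rintro ((i | e) | q) o b h
      · simp [inp] at h
      · exact S.level_lt_of_known μ h
      · exact S.level_lt_of_known μ h)
  -- Different places of the schedule use different coins, so the generic coefficients can be
  -- prescribed independently. Coins that do not occur in `S` are set to `0`.
  let f : (Fin S.numTx ⊕ ({y // y ∈ S.copies} × Fin μ)) × (Fin μ ⊕ S.Label) → RecombCoin V k μ :=
    fun q => (q.1.elim (fun e => Sum.inr e.val)
      (fun r => Sum.inl (r.1.1.1, S.rank r.1.1.2, r.2)), q.2.map id S.name)
  have hf : Function.Injective f := by
    rintro ⟨a, o⟩ ⟨a', o'⟩ h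
    simp only [f, Prod.mk.injEq] at h
    have ho : o = o' := Sum.map_injective.2 ⟨Function.injective_id, S.name_injective⟩ h.2
    subst ho
    rcases a with e | ⟨⟨⟨v, t⟩, hy⟩, j⟩ <;> rcases a' with e' | ⟨⟨⟨v', t'⟩, hy'⟩, j'⟩
    · simpa [Fin.ext_iff] using h.1
    · simp at h
    · simp at h
    · simp only [Sum.elim_inr, Sum.inl.injEq, Prod.mk.injEq] at h
      have ht := (S.rank_inj (S.snd_mem_times hy) (S.snd_mem_times hy')).1 h.1.2.1
      simp only at ht
      simp [h.1.1, h.1.2.2, ht]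
  let cf : (Fin S.numTx ⊕ ({y // y ∈ S.copies} × Fin μ)) × (Fin μ ⊕ S.Label) → K :=
    fun q => c (q.1.elim (fun e => Sum.inl (Sum.inr e)) Sum.inr) q.2
  let c' : RecombCoin V k μ → K := Function.extend f cf 0
  have hsend : ∀ e o, (S.recombCoding μ c').send e o = c (Sum.inl (Sum.inr e)) o := fun e o =>
    hf.extend_apply cf 0 (Sum.inl e, o)
  have hstore : ∀ y (hy : y ∈ S.copies) j o,
      (S.recombCoding μ c').store y j o = c (Sum.inr (⟨y, hy⟩, j)) o := fun y hy j o =>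
    hf.extend_apply cf 0 (Sum.inr (⟨y, hy⟩, j), o)
  have hvec := (S.recombCoding μ c').vec_eq_of_recursion
    (fun x o => (S.known μ x o).elim 0 g)
    (fun x _ h j => by simp [S.known_inl_eq_none μ h])
    (fun x y h j => by
      have hy := (S.mem_memEdges.1 h).1
      rw [S.known_inl_eq_some μ h, Option.elim_some, hgn _ (by simp)]
      simp [hstore y hy, inp])
    (fun x _ p h => by simp [known, h])
    (fun x i h => by rw [S.known_inr μ h, Option.elim_some, hgm])
    (fun x e h => by
      rw [S.known_inr μ h, Option.elim_some, hgn _ (by simp)]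
      simp [hsend, inp])
  refine ⟨c', fun x hx => ?_⟩
  obtain ⟨U, C, hZU, hC, hU⟩ := hsep {b | ∃ o, S.known μ x o = some b}
  have hrank : C.card ≤ (S.recombCoding μ c').rank x := by
    refine hC.trans (Coding.finrank_le_rank _ _ ?_)
    rintro _ ⟨b, ⟨o, ho⟩, rfl⟩
    exact ⟨o, by rw [hvec x hx]; simp [ho]⟩
  refine le_trans ?_ (Nat.cast_le.2 hrank)
  -- If a memory edge enters `W` from `z`, all `μ` cells stored at `z` are in `U`, and hence in `C`:
  -- the edge is charged to the cells at its tail.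
  let W : Set (V × T) := {y | ∀ o b, S.known μ y o = some b → b ∈ U}
  have hC_of : ∀ a : S.Element μ, ∀ z, inp a = S.known μ z → z ∉ W → a ∈ U → a ∈ C := by
    intro a z haz hz haU
    by_contra haC
    exact hz fun o b hb => (hU a haU haC).2 b (Or.inr ⟨o, by rw [haz]; exact hb⟩)
  refine S.minCut_le_card μ W (fun o b h => hZU ⟨o, h⟩) C ?_
    (fun q _ => if h : q.1 ∈ S.copies then ⟨q.1, h⟩ else ⟨x, hx⟩) ?_ ?_
  · intro p hp
    simp only [crossingLabels, Finset.mem_filter, Finset.mem_univ, true_and] at hp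
    obtain ⟨h1, y, hy, hyW⟩ := hp
    have hpU : Sum.inl p ∈ U := hyW _ _ (S.known_inr μ hy)
    cases p with
    | inl i =>
      by_contra hpC
      exact (hU _ hpU hpC).1 ⟨i, rfl⟩
    | inr e => exact hC_of _ (S.tail e) rfl (h1 e rfl) hpU
  · rintro ⟨z, y⟩ hq j
    simp only [crossingMemEdges, Finset.mem_filter] at hq
    have hz := (S.mem_memEdges.1 hq.1).1
    simp only [dif_pos hz]
    exact hC_of _ z rfl hq.2.1 (hq.2.2 _ _ (S.known_inl_eq_some μ hq.1 j))
  · rintro ⟨z, y⟩ hq ⟨z', y'⟩ hq' j h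
    simp only [crossingMemEdges, Finset.mem_filter] at hq hq'
    have hz := S.mem_memEdges.1 hq.1
    have hz' := S.mem_memEdges.1 hq'.1
    simp only [dif_pos hz.1, dif_pos hz'.1, Subtype.mk.injEq] at h
    subst h
    exact Prod.ext rfl (S.memEdges_right_unique hq.1 hq'.1)

theorem exists_memEdge_right (S : Schedule V T k) {u y : V × T} (hu : u ∈ S.copies)
    (hy : y ∈ S.copies) (huy : u.1 = y.1) (hlt : u.2 < y.2) :
    ∃ z, (u, z) ∈ S.memEdges ∧ z.2 ≤ y.2 := by
  classical
  obtain ⟨z, hz, hmin⟩ := Finset.exists_min_image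
    (S.copies.filter fun z => z.1 = u.1 ∧ u.2 < z.2) Prod.snd
    ⟨y, Finset.mem_filter.2 ⟨hy, huy.symm, hlt⟩⟩
  simp only [Finset.mem_filter] at hz hmin
  refine ⟨z, S.mem_memEdges.2 ⟨hu, hz.1, hz.2.1.symm, hz.2.2, fun w hw hwu h => ?_⟩,
    hmin y ⟨hy, huy.symm, hlt⟩⟩
  exact (hmin w ⟨hw, hwu, h.1⟩).not_gt h.2

/-! ### The accumulator -/

/-- The linear protocol underlying the accumulator. -/
def accCoding {R : Type*} [Zero R] [One R] (S : Schedule V T k) (μ : ℕ) (c : AccCoin V k μ → R) :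
    S.Coding (Fin μ) R where
  store := fun x i => Sum.elim (fun j => if j = i then 1 else 0)
    fun p => c (Sum.inl ((x.1, S.rank x.2, i), S.name p))
  send := fun e => Sum.elim (fun j => c (Sum.inr (e, j))) fun _ => 0

/-- Separators of accumulator executions yield cuts. -/
theorem minCut_le_of_accumulator_separator (S : Schedule V T k) (hS : S.HalfDuplex) (μ : ℕ)
    {x : V × T} (hx : x ∈ S.copies) (U : Set (S.Element μ)) (C : Finset (S.Element μ))
    (hxU : ∀ o b, S.known μ x o = some b → b ∈ U)
    (hmsg : ∀ i, Sum.inl (Sum.inl i) ∈ U → Sum.inl (Sum.inl i) ∈ C)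
    (htx : ∀ e, Sum.inl (Sum.inr e) ∈ U → Sum.inl (Sum.inr e) ∉ C →
      ∀ j b, S.known μ (S.tail e) (Sum.inl j) = some b → b ∈ U)
    (hcell : ∀ y j, Sum.inr (y, j) ∈ U → Sum.inr (y, j) ∉ C →
      (∀ b, S.known μ y.1 (Sum.inl j) = some b → b ∈ U) ∧
        ∀ p b, S.known μ y.1 (Sum.inr p) = some b → b ∈ U) :
    (S.infoFlowGraph μ).minCut none (some x) ≤ C.card := by
  classical
  -- Unlike in the recombinator, a cell outside `C` brings only its own old content and the arrivals
  -- into `U`, not the other cells. So the sink side consists of the seeds, at which everything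
  -- known is in `U`, extended backwards along the node as long as a single cell `j` stays in `U`
  -- and outside `C`.
  let seed : V × T → Prop := fun y => y ∈ S.copies ∧ ∀ o b, S.known μ y o = some b → b ∈ U
  let good : {y // y ∈ S.copies} → Fin μ → Prop := fun z j =>
    Sum.inr (z, j) ∈ U ∧ (Sum.inr (z, j) : S.Element μ) ∉ C
  let run : V × T → V × T → Fin μ → Prop := fun y y' j =>
    ∀ z : {y // y ∈ S.copies}, z.1.1 = y.1 → y.2 ≤ z.1.2 → z.1.2 < y'.2 → good z j
  let W : Set (V × T) := {y | y ∈ S.copies ∧ ∃ y', seed y' ∧ y.1 = y'.1 ∧ y.2 ≤ y'.2 ∧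
    (y = y' ∨ ∃ j, run y y' j)}
  have hseedW : ∀ y, seed y → y ∈ W := fun y h => ⟨h.1, y, h, rfl, le_rfl, Or.inl rfl⟩
  -- At a crossing edge the backward extension stops, so every cell `j` meets `C` in the window from
  -- the tail of the edge up to the seed `y'`. All later copies in the window belong to `W`.
  have hkey : ∀ q ∈ S.crossingMemEdges W, ∃ y' : V × T,
      (∀ z ∈ S.copies, z.1 = q.1.1 → q.2.2 ≤ z.2 → z.2 < y'.2 → z ∈ W) ∧
      ∀ j, ∃ u : {y // y ∈ S.copies}, u.1.1 = q.1.1 ∧ q.1.2 ≤ u.1.2 ∧ u.1.2 < y'.2 ∧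
        (Sum.inr (u, j) : S.Element μ) ∈ C := by
    rintro ⟨z, y⟩ hq
    simp only [crossingMemEdges, Finset.mem_filter] at hq
    obtain ⟨hzy, hzW, hyW⟩ := hq
    obtain ⟨hz, hy, hzy1, hzy2, -⟩ := S.mem_memEdges.1 hzy
    obtain ⟨-, y', hy', h1, h2, h3⟩ := hyW
    refine ⟨y', ?_, fun j => ?_⟩
    · intro w hw hwz hyw hwy'
      have hw1 : w.1 = y'.1 := hwz.trans (hzy1.trans h1)
      refine ⟨hw, y', hy', hw1, hwy'.le, ?_⟩
      rcases h3 with rfl | ⟨j, hj⟩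
      · exact absurd hwy' hyw.not_gt
      · exact Or.inr ⟨j, fun u hu hwu huy' =>
          hj u (hu.trans (hwz.trans hzy1)) (hyw.trans hwu) huy'⟩
    · by_contra! hno
      refine hzW ⟨hz, y', hy', hzy1.trans h1, hzy2.le.trans h2, Or.inr ⟨j, ?_⟩⟩
      have hall : ∀ u : {y // y ∈ S.copies}, u.1.1 = z.1 → z.2 ≤ u.1.2 → u.1.2 < y'.2 →
          (Sum.inr (u, j) : S.Element μ) ∈ U := by
        by_contra! hex
        obtain ⟨u₀, hu₀⟩ := hex
        -- Take the latest copy whose cell `j` is not in `U`. The next copy is the seed, which knows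
        -- this content, or it stores a content in `U` outside `C`, whose predecessor must be in
        -- `U`; both are contradictory.
        obtain ⟨u, hu, hmax⟩ := Finset.exists_max_image
          (Finset.univ.filter fun u : {y // y ∈ S.copies} => u.1.1 = z.1 ∧ z.2 ≤ u.1.2 ∧
            u.1.2 < y'.2 ∧ (Sum.inr (u, j) : S.Element μ) ∉ U) (fun u => u.1.2)
          ⟨u₀, by simpa using hu₀⟩
        simp only [Finset.mem_filter, Finset.mem_univ, true_and] at hu hmax
        obtain ⟨hu1, hu2, hu3, hu4⟩ := hu
        obtain ⟨w, huw, hwy'⟩ := S.exists_memEdge_right u.2 hy'.1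
          (hu1.trans (hzy1.trans h1)) hu3
        have hw := S.mem_memEdges.1 huw
        have hk : S.known μ w (Sum.inl j) = some (Sum.inr (u, j)) := S.known_inl_eq_some μ huw j
        rcases hwy'.eq_or_lt with heq | hlt
        · have hwy : w = y' := Prod.ext (hw.2.2.1.symm.trans (hu1.trans (hzy1.trans h1))) heq
          exact hu4 (hy'.2 _ _ (hwy ▸ hk))
        · have hw1 : w.1 = z.1 := hw.2.2.1.symm.trans hu1
          have hw2 : z.2 ≤ w.2 := hu2.trans hw.2.2.2.1.le
          have hwU : (Sum.inr (⟨w, hw.2.1⟩, j) : S.Element μ) ∈ U := by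
            by_contra hwU
            exact (hmax ⟨w, hw.2.1⟩ ⟨hw1, hw2, hlt, hwU⟩).not_gt hw.2.2.2.1
          exact hu4 ((hcell ⟨w, hw.2.1⟩ j hwU (hno ⟨w, hw.2.1⟩ hw1 hw2 hlt)).1 _ hk)
      exact fun u hu1 hu2 hu3 => ⟨hall u hu1 hu2 hu3, hno u hu1 hu2 hu3⟩
  choose! y' hrun cell hc1 hc2 hc3 hc4 using hkey
  refine S.minCut_le_card μ W (hseedW x ⟨hx, hxU⟩) C ?_
    (fun q j => if h : q ∈ S.crossingMemEdges W then cell q h j else ⟨x, hx⟩) ?_ ?_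
  · intro p hp
    simp only [crossingLabels, Finset.mem_filter, Finset.mem_univ, true_and] at hp
    obtain ⟨h1, y, hy, hyc, z, hz, hyz, hyz2, h2⟩ := hp
    have hpU : (Sum.inl p : S.Element μ) ∈ U := by
      rcases hyz2.eq_or_lt with heq | hlt
      · have : y = z := Prod.ext hyz heq
        exact hz.2 _ _ (this ▸ S.known_inr μ hy)
      · rcases h2 with rfl | ⟨j, hj⟩
        · exact absurd hlt (lt_irrefl _)
        · obtain ⟨hg1, hg2⟩ := hj ⟨y, hyc⟩ rfl le_rfl hlt
          exact (hcell ⟨y, hyc⟩ j hg1 hg2).2 _ _ (S.known_inr μ hy)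
    cases p with
    | inl i => exact hmsg i hpU
    | inr e =>
      by_contra hpC
      refine h1 e rfl (hseedW _ ⟨S.tail_mem_copies e, fun o b hb => ?_⟩)
      -- Sending and receiving exclude each other, so the stored cells are all that is known at a
      -- sending copy. If they are in `U`, the tail is a seed.
      cases o with
      | inl j => exact htx e hpU hpC j b hb
      | inr p => simp [known, hS e p] at hb
  · intro q hq j
    rw [dif_pos hq]
    exact hc4 q hq j
  · have hle : ∀ q (hq : q ∈ S.crossingMemEdges W), ∀ q' (hq' : q' ∈ S.crossingMemEdges W), ∀ j,
        cell q hq j = cell q' hq' j → ¬ q.1.2 < q'.1.2 := by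
      intro q hq q' hq' j h hlt
      have hm := hq
      have hm' := hq'
      simp only [crossingMemEdges, Finset.mem_filter] at hm hm'
      have he := S.mem_memEdges.1 hm.1
      have he' := S.mem_memEdges.1 hm'.1
      have hn : q'.1.1 = q.1.1 := by
        rw [← hc1 q hq j, ← hc1 q' hq' j, h]
      refine hm'.2.1 (hrun q hq _ he'.1 hn ?_ ?_)
      · by_contra hlt'
        exact he.2.2.2.2 _ he'.1 hn ⟨hlt, not_le.1 hlt'⟩
      · have := hc2 q' hq' j
        rw [← h] at this
        exact this.trans_lt (hc3 q hq j)
    intro q hq q' hq' j h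
    rw [dif_pos hq, dif_pos hq'] at h
    have hn : q.1.1 = q'.1.1 := by
      rw [← hc1 q hq j, ← hc1 q' hq' j, h]
    have h1 : q.1 = q'.1 := Prod.ext hn (le_antisymm (not_lt.1 (hle q' hq' q hq j h.symm))
      (not_lt.1 (hle q hq q' hq' j h)))
    simp only [crossingMemEdges, Finset.mem_filter] at hq hq'
    obtain ⟨z, y⟩ := q
    obtain ⟨z', y'⟩ := q'
    simp only at h1
    subst h1
    exact Prod.ext rfl (S.memEdges_right_unique hq.1 hq'.1)

/-- The old content of a cell enters the new one with coefficient `1` and is therefore the `base`;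
only arriving packets have free coefficients there. Genericity still forces the base into the span,
because no other fixed summand occurs. -/
theorem exists_accCoding_rank {K : Type*} [Field K] [Infinite K] (S : Schedule V T k)
    (hS : S.HalfDuplex) (μ : ℕ) :
    ∃ c : AccCoin V k μ → K, ∀ x ∈ S.copies,
      (S.infoFlowGraph μ).minCut none (some x) ≤ (S.accCoding μ c).rank x := by
  classical
  let inp : S.Element μ → Fin μ ⊕ S.Label → Option (S.Element μ) :=
    Sum.elim (Sum.elim (fun _ _ => none)
      fun e => Sum.elim (fun j => S.known μ (S.tail e) (Sum.inl j)) fun _ => none)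
      fun q => Sum.elim (fun _ => none) fun p => S.known μ q.1.1 (Sum.inr p)
  let base : S.Element μ → Option (S.Element μ) :=
    Sum.elim (fun _ => none) fun q => S.known μ q.1.1 (Sum.inl q.2)
  have hnm : ∀ a : S.Element μ, a ∉ Set.range (fun i : Fin k => Sum.inl (Sum.inl i)) →
      0 < S.level μ a := by
    rintro ((i | e) | q) h
    · exact absurd ⟨i, rfl⟩ h
    · exact Nat.succ_pos _
    · exact Nat.succ_pos _
  obtain ⟨c, g, hgm, hgn, hsep⟩ := exists_generic_system (K := K) (S.level μ)
    (fun i : Fin k => Sum.inl (Sum.inl i))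
    (Sum.inl_injective.comp Sum.inl_injective) base inp (fun _ => rfl) hnm
    (fun _ => rfl) (fun _ _ => rfl) (by
      rintro (p | q) b h
      · simp [base] at h
      · exact S.level_lt_of_known μ (o := Sum.inl q.2) h) (by
      rintro ((i | e) | q) (j | p) b h
      · simp [inp] at h
      · simp [inp] at h
      · exact S.level_lt_of_known μ (o := Sum.inl j) h
      · simp [inp] at h
      · simp [inp] at h
      · exact S.level_lt_of_known μ (o := Sum.inr p) h)
  let f : (({y // y ∈ S.copies} × Fin μ) × S.Label) ⊕ (Fin S.numTx × Fin μ) → AccCoin V k μ :=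
    Sum.map (fun r => ((r.1.1.1.1, S.rank r.1.1.1.2, r.1.2), S.name r.2)) (Prod.map Fin.val id)
  have hf : Function.Injective f := by
    refine Sum.map_injective.2 ⟨?_, Fin.val_injective.prodMap Function.injective_id⟩
    rintro ⟨⟨⟨⟨v, t⟩, hy⟩, j⟩, p⟩ ⟨⟨⟨⟨v', t'⟩, hy'⟩, j'⟩, p'⟩ h
    simp only [Prod.mk.injEq] at h
    have ht := (S.rank_inj (S.snd_mem_times hy) (S.snd_mem_times hy')).1 h.1.2.1
    simp only at ht
    simp [h.1.1, h.1.2.2, ht, S.name_injective h.2]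
  let cf : (({y // y ∈ S.copies} × Fin μ) × S.Label) ⊕ (Fin S.numTx × Fin μ) → K :=
    Sum.elim (fun r => c (Sum.inr r.1) (Sum.inr r.2))
      fun r => c (Sum.inl (Sum.inr r.1)) (Sum.inl r.2)
  let c' : AccCoin V k μ → K := Function.extend f cf 0
  have hsend : ∀ (e : Fin S.numTx) (j : Fin μ), c' (Sum.inr (e.val, j)) =
      c (Sum.inl (Sum.inr e)) (Sum.inl j) := fun e j =>
    hf.extend_apply cf 0 (Sum.inr (e, j))
  have hstore : ∀ y (hy : y ∈ S.copies) (j : Fin μ) p,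
      c' (Sum.inl ((y.1, S.rank y.2, j), S.name p)) =
        c (Sum.inr (⟨y, hy⟩, j)) (Sum.inr p) := fun y hy j p =>
    hf.extend_apply cf 0 (Sum.inl ((⟨y, hy⟩, j), p))
  have hvec := (S.accCoding μ c').vec_eq_of_recursion
    (fun x o => (S.known μ x o).elim 0 g)
    (fun x _ h j => by simp [S.known_inl_eq_none μ h])
    (fun x y h j => by
      have hy := (S.mem_memEdges.1 h).1
      rw [S.known_inl_eq_some μ h, Option.elim_some, hgn _ (by simp), Fintype.sum_sum_type,
        Fintype.sum_sum_type]
      simp [accCoding, hstore y hy, inp, base, ite_smul])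
    (fun x _ p h => by simp [known, h])
    (fun x i h => by rw [S.known_inr μ h, Option.elim_some, hgm])
    (fun x e h => by
      rw [S.known_inr μ h, Option.elim_some, hgn _ (by simp), Fintype.sum_sum_type,
        Fintype.sum_sum_type]
      simp [accCoding, hsend, inp, base])
  refine ⟨c', fun x hx => ?_⟩
  obtain ⟨U, C, hZU, hC, hU⟩ := hsep {b | ∃ o, S.known μ x o = some b}
  have hrank : C.card ≤ (S.accCoding μ c').rank x := by
    refine hC.trans (Coding.finrank_le_rank _ _ ?_)
    rintro _ ⟨b, ⟨o, ho⟩, rfl⟩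
    exact ⟨o, by rw [hvec x hx]; simp [ho]⟩
  refine le_trans ?_ (Nat.cast_le.2 hrank)
  refine S.minCut_le_of_accumulator_separator hS μ hx U C (fun o b h => hZU ⟨o, h⟩) ?_ ?_ ?_
  · intro i hi
    by_contra hiC
    exact (hU _ hi hiC).1 ⟨i, rfl⟩
  · exact fun e he heC j b hb => (hU _ he heC).2 b (Or.inr ⟨Sum.inl j, hb⟩)
  · exact fun y j hy hyC => ⟨fun b hb => (hU _ hy hyC).2 b (Or.inl hb),
      fun p b hb => (hU _ hy hyC).2 b (Or.inr ⟨Sum.inr p, hb⟩)⟩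

/-! ### PNC -/

open scoped Classical in
/-- The linear protocol underlying PNC. -/
def pncCoding {R : Type*} [Zero R] [One R] (S : Schedule V T k) (c : PncCoin k → R) :
    S.Coding S.Label R where
  store := fun x p => Sum.elim (fun p' => if p' = p ∧ x ∉ S.heads p then 1 else 0)
    fun p' => if p' = p ∧ x ∈ S.heads p then 1 else 0
  send := fun e => Sum.elim (fun p => if S.tail e ∈ S.heads p then 0 else c (e, S.name p))
    fun p => if S.tail e ∈ S.heads p then c (e, S.name p) else 0

/-- Packet `p` has arrived at the node of `x` before `x`. -/
def ReceivedBefore (S : Schedule V T k) (x : V × T) (p : S.Label) : Prop :=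
  ∃ y ∈ S.heads p, y.1 = x.1 ∧ y.2 < x.2

theorem receivedBefore_iff (S : Schedule V T k) {x y : V × T} (h : (y, x) ∈ S.memEdges)
    (p : S.Label) : S.ReceivedBefore x p ↔ y ∈ S.heads p ∨ S.ReceivedBefore y p := by
  obtain ⟨hy, hx, h1, h2, h3⟩ := S.mem_memEdges.1 h
  constructor
  · rintro ⟨z, hz, hzx, hlt⟩
    rcases lt_trichotomy z.2 y.2 with h' | h' | h'
    · exact Or.inr ⟨z, hz, hzx.trans h1.symm, h'⟩
    · have : z = y := Prod.ext (hzx.trans h1.symm) h'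
      exact Or.inl (this ▸ hz)
    · exact absurd ⟨h', hlt⟩ (h3 z (S.mem_copies_of_mem_heads hz) (hzx.trans h1.symm))
  · rintro (h' | ⟨z, hz, hzy, hlt⟩)
    · exact ⟨y, h', h1, h2⟩
    · exact ⟨z, hz, hzy.trans h1, hlt.trans h2⟩

/-- Nothing is forgotten, so labels alone are the elements and knowledge grows along each node. If
all that is known at a copy is in `U`, this holds at the earlier copies of the node as well, so no
edge of infinite capacity crosses the cut. -/
theorem exists_pncCoding_rank {K : Type*} [Field K] [Infinite K] (S : Schedule V T k) :
    ∃ c : PncCoin k → K, ∀ x ∈ S.copies,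
      (S.infoFlowGraph ⊤).minCut none (some x) ≤ (S.pncCoding c).rank x := by
  classical
  let has : V × T → S.Label → Prop := fun x p => x ∈ S.heads p ∨ S.ReceivedBefore x p
  let inp : S.Label → S.Label → Option S.Label :=
    Sum.elim (fun _ _ => none) fun e p => if has (S.tail e) p then some p else none
  let lvl : S.Label → ℕ := Sum.elim (fun _ => 0) fun e => S.rank (S.tail e).2 + 1
  obtain ⟨c, g, hgm, hgn, hsep⟩ := exists_generic_system (K := K) lvl Sum.inl Sum.inl_injective
    (fun _ => none) inp (fun _ => rfl) (by
      rintro (i | e) h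
      · exact absurd ⟨i, rfl⟩ h
      · exact Nat.succ_pos _)
    (fun _ => rfl) (fun _ _ => rfl) (fun _ _ h => by simp at h) (by
      rintro (i | e) p b h
      · simp [inp] at h
      · simp only [inp, Sum.elim_inr] at h
        split_ifs at h with hp
        obtain rfl := Option.some_injective _ h
        cases p with
        | inl i => exact Nat.succ_pos _
        | inr e' =>
          refine Nat.succ_lt_succ (S.rank_lt_rank (S.snd_mem_times (S.tail_mem_copies e')) ?_)
          rcases hp with hp | ⟨y, hy, -, hlt⟩
          · exact S.causal e' _ hp
          · exact (S.causal e' _ hy).trans hlt)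
  let f : Fin S.numTx × S.Label → PncCoin k := Prod.map Fin.val S.name
  have hf : Function.Injective f := Fin.val_injective.prodMap S.name_injective
  let cf : Fin S.numTx × S.Label → K := fun r => c (Sum.inr r.1) r.2
  let c' : PncCoin k → K := Function.extend f cf 0
  have hc : ∀ (e : Fin S.numTx) (p : S.Label), c' (e.val, S.name p) = c (Sum.inr e) p :=
    fun e p => hf.extend_apply cf 0 (e, p)
  -- A cell is filled once its packet has arrived strictly before `x`; what arrives at `x` itself is
  -- listed separately.
  let Wv : V × T → S.Label ⊕ S.Label → Fin k → K := fun x =>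
    Sum.elim (fun p => if S.ReceivedBefore x p then g p else 0)
      fun p => if x ∈ S.heads p then g p else 0
  have hvec := (S.pncCoding c').vec_eq_of_recursion Wv
    (fun x _ h p => by
      refine if_neg ?_
      rintro ⟨y, hy, hyx, hlt⟩
      exact h y (S.mem_copies_of_mem_heads hy) hyx hlt)
    (fun x y h p => by
      have hsingle : ∀ (P : Prop) [Decidable P] [∀ p', Decidable (p' = p ∧ P)]
          (F : S.Label → Fin k → K),
          ∑ p', (if p' = p ∧ P then (1 : K) else 0) • F p' = if P then F p else 0 := by
        intro P _ _ F
        rw [Finset.sum_eq_single p (fun p' _ hne => by simp [hne]) (by simp)]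
        split_ifs <;> simp_all
      rw [Fintype.sum_sum_type (α₁ := S.Label) (α₂ := S.Label)]
      simp only [Wv, Sum.elim_inl, Sum.elim_inr, pncCoding, hsingle, S.receivedBefore_iff h]
      by_cases hp : y ∈ S.heads p <;> simp [hp])
    (fun x _ p h => by simp [Wv, h])
    (fun x i h => by simp [Wv, h, hgm])
    (fun x e h => by
      simp only [Wv, Sum.elim_inr, h, if_true]
      rw [hgn _ (by simp)]
      rw [Fintype.sum_sum_type (α₁ := S.Label) (α₂ := S.Label)]
      simp only [pncCoding, Sum.elim_inl, Sum.elim_inr, Option.elim_none,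
        zero_add, ← Finset.sum_add_distrib, inp, hc]
      -- A packet that is stored and arrives once more is counted only once: the arrival takes
      -- precedence over the cell.
      refine Finset.sum_congr rfl fun p _ => ?_
      by_cases h1 : S.tail e ∈ S.heads p <;> by_cases h2 : S.ReceivedBefore (S.tail e) p <;>
        simp [h1, h2, has])
  refine ⟨c', fun x hx => ?_⟩
  obtain ⟨U, C, hZU, hC, hU⟩ := hsep {p | has x p}
  have hrank : C.card ≤ (S.pncCoding c').rank x := by
    refine hC.trans (Coding.finrank_le_rank _ _ ?_)
    rintro _ ⟨p, hp | hp, rfl⟩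
    · exact ⟨Sum.inr p, by rw [hvec x hx]; simp [Wv, hp]⟩
    · exact ⟨Sum.inl p, by rw [hvec x hx]; simp [Wv, hp]⟩
  refine le_trans ?_ (Nat.cast_le.2 hrank)
  let W : Set (V × T) := {y | ∀ p, has y p → p ∈ U}
  refine (S.minCut_le ⊤ W (fun p hp => hZU hp)).trans ?_
  have hM : S.crossingMemEdges W = ∅ := by
    refine Finset.eq_empty_iff_forall_notMem.2 ?_
    rintro ⟨z, y⟩ hq
    simp only [crossingMemEdges, Finset.mem_filter] at hq
    obtain ⟨hzy, hz, hy⟩ := hq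
    exact hz fun p hp => hy p (Or.inr ((S.receivedBefore_iff hzy p).2 hp))
  rw [hM, Finset.card_empty, Nat.cast_zero, zero_mul, add_zero]
  refine Nat.cast_le.2 (Finset.card_le_card fun p hp => ?_)
  simp only [crossingLabels, Finset.mem_filter, Finset.mem_univ, true_and] at hp
  obtain ⟨h1, y, hy, hyW⟩ := hp
  have hpU : p ∈ U := hyW p (Or.inl hy)
  by_contra hpC
  cases p with
  | inl i => exact (hU _ hpU hpC).1 ⟨i, rfl⟩
  | inr e =>
    refine h1 e rfl fun p' hp' => (hU _ hpU hpC).2 p' (Or.inr ⟨p', ?_⟩)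
    simp [inp, hp']

/-! ### Changing the times of a schedule -/

/-- The same events with all times changed by an order preserving map. -/
def mapTimes {T' : Type*} [LinearOrder T'] (S : Schedule V T k) (φ : T → T')
    (h : StrictMonoOn φ S.times) : Schedule V T' k where
  numTx := S.numTx
  tail := fun e => ((S.tail e).1, φ (S.tail e).2)
  recv := fun e => by
    classical exact (S.recv e).image (fun y => (y.1, φ y.2))
  gen := fun i => by
    classical exact (S.gen i).image (fun y => (y.1, φ y.2))
  causal := by
    intro e y hy
    classical
    obtain ⟨z, hz, rfl⟩ := Finset.mem_image.1 hy
    exact h (S.snd_mem_times (S.tail_mem_copies e))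
      (S.snd_mem_times (S.mem_copies_of_mem_heads (p := Sum.inr e) hz)) (S.causal e z hz)

section MapTimes

variable {T' : Type*} [LinearOrder T'] (S : Schedule V T k) (φ : T → T')
  (h : StrictMonoOn φ S.times)

theorem mem_heads_mapTimes {p : S.Label} {z : V × T'} :
    z ∈ (S.mapTimes φ h).heads p ↔ ∃ y ∈ S.heads p, (y.1, φ y.2) = z := by
  classical
  cases p with
  | inl i => exact Finset.mem_image
  | inr e => exact Finset.mem_image

theorem mem_copies_mapTimes {z : V × T'} :
    z ∈ (S.mapTimes φ h).copies ↔ ∃ y ∈ S.copies, (y.1, φ y.2) = z := by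
  rw [mem_copies_iff]
  constructor
  · rintro (⟨e, rfl⟩ | ⟨p, hp⟩)
    · exact ⟨S.tail e, S.tail_mem_copies e, rfl⟩
    · obtain ⟨y, hy, rfl⟩ := (S.mem_heads_mapTimes φ h).1 hp
      exact ⟨y, S.mem_copies_of_mem_heads hy, rfl⟩
  · rintro ⟨y, hy, rfl⟩
    rcases S.mem_copies_iff.1 hy with ⟨e, rfl⟩ | ⟨p, hp⟩
    · exact Or.inl ⟨e, rfl⟩
    · exact Or.inr ⟨p, (S.mem_heads_mapTimes φ h).2 ⟨y, hp, rfl⟩⟩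

variable {S φ h}

theorem mem_copies_mapTimes_of_mem {x : V × T} (hx : x ∈ S.copies) :
    (x.1, φ x.2) ∈ (S.mapTimes φ h).copies :=
  (S.mem_copies_mapTimes φ h).2 ⟨x, hx, rfl⟩

theorem mem_heads_mapTimes_iff {p : S.Label} {x : V × T} (hx : x ∈ S.copies) :
    (x.1, φ x.2) ∈ (S.mapTimes φ h).heads p ↔ x ∈ S.heads p := by
  rw [mem_heads_mapTimes]
  refine ⟨fun ⟨y, hy, hyx⟩ => ?_, fun hx => ⟨x, hx, rfl⟩⟩
  rw [Prod.mk.injEq] at hyx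
  have : y = x := Prod.ext hyx.1 (h.injOn (S.snd_mem_times (S.mem_copies_of_mem_heads hy))
    (S.snd_mem_times hx) hyx.2)
  exact this ▸ hy

theorem mem_memEdges_mapTimes {x y : V × T} (hyx : (y, x) ∈ S.memEdges) :
    ((y.1, φ y.2), (x.1, φ x.2)) ∈ (S.mapTimes φ h).memEdges := by
  obtain ⟨hy, hx, h1, h2, h3⟩ := S.mem_memEdges.1 hyx
  have ht := fun {z : V × T} (hz : z ∈ S.copies) => S.snd_mem_times hz
  refine mem_memEdges _ |>.2 ⟨mem_copies_mapTimes_of_mem hy, mem_copies_mapTimes_of_mem hx, h1,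
    h (ht hy) (ht hx) h2, ?_⟩
  intro z hz hzy hlt
  obtain ⟨w, hw, rfl⟩ := (S.mem_copies_mapTimes φ h).1 hz
  exact h3 w hw hzy ⟨(h.lt_iff_lt (ht hy) (ht hw)).1 hlt.1, (h.lt_iff_lt (ht hw) (ht hx)).1 hlt.2⟩

theorem mem_times_mapTimes {u : T'} : u ∈ (S.mapTimes φ h).times ↔ ∃ t ∈ S.times, φ t = u := by
  classical
  simp only [times, Finset.mem_image, mem_copies_mapTimes]
  constructor
  · rintro ⟨_, ⟨y, hy, rfl⟩, rfl⟩
    exact ⟨y.2, ⟨y, hy, rfl⟩, rfl⟩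
  · rintro ⟨_, ⟨y, hy, rfl⟩, rfl⟩
    exact ⟨_, ⟨y, hy, rfl⟩, rfl⟩

theorem rank_mapTimes {t : T} (ht : t ∈ S.times) : (S.mapTimes φ h).rank (φ t) = S.rank t := by
  classical
  have : (S.mapTimes φ h).times.filter (· < φ t) = (S.times.filter (· < t)).image φ := by
    ext u
    simp only [Finset.mem_filter, Finset.mem_image, mem_times_mapTimes]
    constructor
    · rintro ⟨⟨s, hs, rfl⟩, hlt⟩
      exact ⟨s, ⟨hs, (h.lt_iff_lt hs ht).1 hlt⟩, rfl⟩
    · rintro ⟨s, ⟨hs, hlt⟩, rfl⟩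
      exact ⟨⟨s, hs, rfl⟩, h hs ht hlt⟩
  rw [rank, this, Finset.card_image_of_injOn]
  · rfl
  · exact h.injOn.mono fun s hs => (Finset.mem_filter.1 hs).1

theorem size_mapTimes_le : (S.mapTimes φ h).size ≤ S.size := by
  classical
  have : (S.mapTimes φ h).copies ⊆ S.copies.image fun y => (y.1, φ y.2) := fun z hz => by
    obtain ⟨y, hy, rfl⟩ := (S.mem_copies_mapTimes φ h).1 hz
    exact Finset.mem_image_of_mem _ hy
  have h1 := (Finset.card_le_card this).trans Finset.card_image_le
  have h2 : (S.mapTimes φ h).numTx = S.numTx := rfl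
  simp only [size, h2]
  omega

theorem Coding.vec_mapTimes [Fintype Slot] {R : Type*} [Semiring R] (a : S.Coding Slot R)
    (b : (S.mapTimes φ h).Coding Slot R)
    (hstore : ∀ x ∈ S.copies, ∀ j o, b.store (x.1, φ x.2) j o = a.store x j o)
    (hsend : ∀ e o, b.send e o = a.send e o) :
    ∀ x ∈ S.copies, a.vec x = b.vec (x.1, φ x.2) := by
  refine a.vec_eq_of_recursion (fun x => b.vec (x.1, φ x.2)) ?_ ?_ ?_ ?_ ?_
  · intro x hx hf j
    refine b.vec_inl_of_first (fun z hz hzx hlt => ?_) j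
    obtain ⟨y, hy, rfl⟩ := (S.mem_copies_mapTimes φ h).1 hz
    exact hf y hy hzx ((h.lt_iff_lt (S.snd_mem_times hy) (S.snd_mem_times hx)).1 hlt)
  · intro x y hyx j
    exact (b.vec_inl_of_memEdge (mem_memEdges_mapTimes hyx) j).trans
      (Finset.sum_congr rfl fun o _ =>
        congrArg (· • b.vec (y.1, φ y.2) o) (hstore y (S.mem_memEdges.1 hyx).1 j o))
  · intro x hx p hp
    exact b.vec_inr_of_notMem (p := p) (by rwa [mem_heads_mapTimes_iff hx])
  · intro x i hx
    exact b.vec_inr_message ((mem_heads_mapTimes_iff (S.mem_copies_of_mem_heads hx)).2 hx)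
  · intro x e hx
    refine (b.vec_inr_transmission (e := e)
      ((mem_heads_mapTimes_iff (S.mem_copies_of_mem_heads hx)).2 hx)).trans ?_
    exact Finset.sum_congr rfl fun o _ =>
      congrArg (· • b.vec ((S.tail e).1, φ (S.tail e).2) o) (hsend e o)

end MapTimes

theorem strictMonoOn_rank (S : Schedule V T k) : StrictMonoOn S.rank S.times :=
  fun _ hs _ _ hlt => S.rank_lt_rank hs hlt

/-- The schedule whose times are the numbers of the events. -/
def canon (S : Schedule V T k) : Schedule V ℕ k :=
  S.mapTimes S.rank S.strictMonoOn_rank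

theorem mk_congr {n : ℕ} {t t' : Fin n → V × T} {r r' : Fin n → Finset (V × T)}
    {g g' : Fin k → Finset (V × T)} {h h'} (ht : t = t') (hr : r = r') (hg : g = g') :
    (⟨n, t, r, g, h⟩ : Schedule V T k) = ⟨n, t', r', g', h'⟩ := by
  subst ht hr hg
  rfl

/-- Ranks do not change under order preserving maps. Hence the events `S.canon = κ` belong to the
σ-algebra of observable events, and for countable `V` there are countably many `κ`: a random
schedule becomes a discrete variable. -/
theorem canon_retime (S : Schedule V T k) (φ : T → T) (h : StrictMonoOn φ S.times) :
    (S.retime φ h).canon = S.canon := by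
  change (S.mapTimes φ h).canon = S.canon
  have hrank : ∀ {p : S.Label} {x : V × T}, x ∈ S.heads p →
      (S.mapTimes φ h).rank (φ x.2) = S.rank x.2 := fun hx =>
    rank_mapTimes (S.snd_mem_times (S.mem_copies_of_mem_heads hx))
  have key : ∀ (p : S.Label) (z : V × ℕ),
      z ∈ ((S.mapTimes φ h).canon).heads p ↔ z ∈ S.canon.heads p := by
    intro p z
    refine (mem_heads_mapTimes _ _ _).trans (Iff.trans ?_ (mem_heads_mapTimes _ _ _).symm)
    constructor
    · rintro ⟨y, hy, rfl⟩
      obtain ⟨x, hx, rfl⟩ := (S.mem_heads_mapTimes φ h).1 hy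
      exact ⟨x, hx, Prod.ext rfl (hrank hx).symm⟩
    · rintro ⟨x, hx, rfl⟩
      exact ⟨(x.1, φ x.2), (S.mem_heads_mapTimes φ h).2 ⟨x, hx, rfl⟩, Prod.ext rfl (hrank hx)⟩
  refine mk_congr (funext fun e => ?_) (funext fun e => ?_) (funext fun i => ?_)
  · have := rank_mapTimes (h := h) (S.snd_mem_times (S.tail_mem_copies e))
    exact congrArg (Prod.mk (S.tail e).1) this
  · exact Finset.ext fun z => key (Sum.inr e) z
  · exact Finset.ext fun z => key (Sum.inl i) z

theorem measurableSet_canon_eq (κ : Schedule V ℕ k) :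
    MeasurableSet {S : Schedule V T k | S.canon = κ} := by
  intro S φ h
  change S.canon = κ ↔ (S.retime φ h).canon = κ
  rw [canon_retime]

instance [Countable V] : Countable (Schedule V ℕ k) := by
  let f : Schedule V ℕ k → Σ n : ℕ, (Fin n → V × ℕ) × (Fin n → Finset (V × ℕ)) ×
    (Fin k → Finset (V × ℕ)) := fun S => ⟨S.numTx, S.tail, S.recv, S.gen⟩
  refine Function.Injective.countable (f := f) ?_
  rintro ⟨n, t, r, g, h⟩ ⟨n', t', r', g', h'⟩ heq
  simp only [f, Sigma.mk.injEq] at heq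
  obtain ⟨rfl, heq⟩ := heq
  simp only [heq_eq_eq, Prod.mk.injEq] at heq
  exact mk_congr heq.1 heq.2.1 heq.2.2

/-! ### Bad coefficients are zeros of a polynomial -/

/-- Each event contributes at most one factor of degree `1` along any path, so the degree is bounded
by the number of earlier event times. -/
theorem Coding.totalDegree_vec_le {S : Schedule V T k} [Fintype Slot] {F ι : Type*} [Field F]
    (a : S.Coding Slot (MvPolynomial ι F)) (hstore : ∀ x j o, (a.store x j o).totalDegree ≤ 1)
    (hsend : ∀ e o, (a.send e o).totalDegree ≤ 1) :
    ∀ x ∈ S.copies, ∀ o i, (a.vec x o i).totalDegree ≤ S.rank x.2 := by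
  classical
  refine S.copies_induction fun x hx ih o i => ?_
  have hsum : ∀ (y : V × T), y ∈ S.copies → y.2 < x.2 → ∀ f : Slot ⊕ S.Label → MvPolynomial ι F,
      (∀ o, (f o).totalDegree ≤ 1) →
      ((∑ o, f o • a.vec y o) i).totalDegree ≤ S.rank x.2 := by
    intro y hy hlt f hf
    rw [Finset.sum_apply]
    refine MvPolynomial.totalDegree_finsetSum_le fun o _ => ?_
    rw [Pi.smul_apply, smul_eq_mul]
    have h1 := MvPolynomial.totalDegree_mul (f o) (a.vec y o i)
    have h2 := ih y hy hlt o i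
    have h3 := S.rank_lt_rank (S.snd_mem_times hy) hlt
    have h4 := hf o
    omega
  cases o with
  | inl j =>
    rcases S.first_or_exists_memEdge hx with h | ⟨y, h⟩
    · simp [a.vec_inl_of_first h]
    · rw [a.vec_inl_of_memEdge h]
      obtain ⟨hy, -, -, hlt, -⟩ := S.mem_memEdges.1 h
      exact hsum y hy hlt _ (hstore y j)
  | inr p =>
    by_cases h : x ∈ S.heads p
    · cases p with
      | inl i' =>
        rw [a.vec_inr_message h, Pi.single_apply]
        split_ifs <;> simp
      | inr e =>
        rw [a.vec_inr_transmission h]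
        exact hsum _ (S.tail_mem_copies e) (S.causal e x h) _ (hsend e)
    · simp [a.vec_inr_of_notMem h]

/-- One minor per copy suffices, and their product has degree at most `|copies| * (k * |copies|)`.
The polynomial depends on the coding only, not on a chosen point `c₀`. -/
theorem Coding.exists_polynomial {S : Schedule V T k} [Fintype Slot] {F ι : Type*} (K : Type*)
    [Field F] [Field K] [Algebra F K] (a : S.Coding Slot (MvPolynomial ι F))
    (hstore : ∀ x j o, (a.store x j o).totalDegree ≤ 1)
    (hsend : ∀ e o, (a.send e o).totalDegree ≤ 1) :
    ∃ p : MvPolynomial ι F, p ≠ 0 ∧ p.totalDegree ≤ S.size ^ 3 ∧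
      ∀ c : ι → F, MvPolynomial.eval c p ≠ 0 → ∀ x ∈ S.copies, ∀ c₀ : ι → K,
        (a.map (MvPolynomial.aeval c₀ : _ →ₐ[F] K).toRingHom).rank x ≤
          (a.map (MvPolynomial.eval c)).rank x := by
  classical
  have key : ∀ x : {x // x ∈ S.copies}, ∃ p : MvPolynomial ι F, p ≠ 0 ∧
      p.totalDegree ≤ k * S.copies.card ∧
      ∀ c : ι → F, MvPolynomial.eval c p ≠ 0 → ∀ c₀ : ι → K,
        (a.map (MvPolynomial.aeval c₀ : _ →ₐ[F] K).toRingHom).rank x.1 ≤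
          (a.map (MvPolynomial.eval c)).rank x.1 := by
    rintro ⟨x, hx⟩
    let r : (ι → K) → ℕ := fun c₀ =>
      (a.map (MvPolynomial.aeval c₀ : _ →ₐ[F] K).toRingHom).rank x
    have hbdd : BddAbove (Set.range r) := by
      refine ⟨k, ?_⟩
      rintro _ ⟨c₀, rfl⟩
      exact (Submodule.finrank_le _).trans (by simp)
    -- Ranks are bounded by `k`, so the largest one over all points is attained; its minor serves
    -- all `c₀`.
    obtain ⟨c₁, hc₁⟩ := Nat.sSup_mem (Set.range_nonempty r) hbdd
    obtain ⟨p, hp0, hpd, hp⟩ := exists_polynomial_of_rank (K := K) (a.vec x)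
      (fun o i => (a.totalDegree_vec_le hstore hsend x hx o i).trans
        (S.rank_lt_card_copies hx).le) c₁
    refine ⟨p, hp0, hpd, fun c hc c₀ => ?_⟩
    have h1 : r c₀ ≤ r c₁ := by
      rw [hc₁]
      exact le_csSup hbdd ⟨c₀, rfl⟩
    refine h1.trans ?_
    have h2 := hp c hc
    have e1 : (a.map (MvPolynomial.aeval c₁ : _ →ₐ[F] K).toRingHom).vec x =
        fun o i => MvPolynomial.aeval c₁ (a.vec x o i) := by
      funext o i
      exact a.vec_map _ hx o i
    have e2 : (a.map (MvPolynomial.eval c)).vec x =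
        fun o i => MvPolynomial.eval c (a.vec x o i) := by
      funext o i
      exact a.vec_map _ hx o i
    change Module.finrank K (Submodule.span K (Set.range
      ((a.map (MvPolynomial.aeval c₁ : _ →ₐ[F] K).toRingHom).vec x))) ≤
      Module.finrank F (Submodule.span F (Set.range ((a.map (MvPolynomial.eval c)).vec x)))
    rw [e1, e2]
    exact h2
  choose p hp0 hpd hp using key
  refine ⟨∏ x, p x, Finset.prod_ne_zero_iff.2 fun x _ => hp0 x, ?_, fun c hc x hx => ?_⟩
  · refine (MvPolynomial.totalDegree_finsetProd _ _).trans ?_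
    refine (Finset.sum_le_card_nsmul _ _ _ fun x _ => hpd x).trans ?_
    rw [Finset.card_univ, Fintype.card_coe, smul_eq_mul, pow_succ', pow_two]
    have h1 : S.copies.card ≤ S.size := by unfold size; omega
    have h2 : k ≤ S.size := by unfold size; omega
    gcongr
  · rw [map_prod] at hc
    exact hp ⟨x, hx⟩ c (Finset.prod_ne_zero_iff.1 hc ⟨x, hx⟩ (Finset.mem_univ _))

/-! ### Random schedules and coefficients -/

/-- The set is a cylinder over the finitely many variables of `p`. -/
theorem measurableSet_eval_eq_zero {F ι : Type*} [Field F] [Finite F] [MeasurableSpace F]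
    [MeasurableSingletonClass F] (p : MvPolynomial ι F) :
    MeasurableSet {c : ι → F | MvPolynomial.eval c p = 0} := by
  obtain ⟨n, f, -, r, rfl⟩ := MvPolynomial.exists_fin_rename p
  have hm : Measurable fun c : ι → F => c ∘ f :=
    measurable_pi_lambda _ fun i => measurable_pi_apply (f i)
  have := hm (Set.toFinite {y : Fin n → F | MvPolynomial.eval y r = 0}).measurableSet
  convert this using 1
  ext c
  simp [MvPolynomial.eval_rename]

/-- Given `canon = κ` the polynomial is fixed, and independence multiplies the Schwartz–Zippel bound
by the probability of this event. The events are disjoint, so summing over `κ` costs nothing. The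
failure set itself need not be measurable; it is only covered, up to a null set. -/
theorem NonAdaptive.measure_not_le {Ω F ι : Type*} [Countable V] [Field F] [Fintype F]
    [MeasurableSpace F] [MeasurableSingletonClass F] [MeasurableSpace Ω] {P : Measure Ω}
    [IsProbabilityMeasure P] {G : Ω → Schedule V T k} {Y : Ω → ι → F} (hY : NonAdaptive P G Y)
    {N : ℕ} (hN : ∀ᵐ ω ∂P, (G ω).size ≤ N) (good : Schedule V T k → (ι → F) → Prop)
    (p : Schedule V ℕ k → MvPolynomial ι F) (hp : ∀ κ, p κ ≠ 0)
    (hdeg : ∀ κ, (p κ).totalDegree ≤ κ.size ^ 3)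
    (hgood : ∀ᵐ ω ∂P, ∀ c, MvPolynomial.eval c (p (G ω).canon) ≠ 0 → good (G ω) c) :
    P {ω | ¬ good (G ω) (Y ω)} ≤ ((N ^ 3 : ℕ) : ENNReal) / Fintype.card F := by
  set ε : ENNReal := ((N ^ 3 : ℕ) : ENNReal) / Fintype.card F with hε
  let I := {κ : Schedule V ℕ k // κ.size ≤ N}
  let A : I → Set Ω := fun κ => G ⁻¹' {S | S.canon = κ.1}
  let B : I → Set Ω := fun κ => Y ⁻¹' {c | MvPolynomial.eval c (p κ.1) = 0}
  have hsub : P {ω | ¬ good (G ω) (Y ω)} ≤ P (⋃ κ, A κ ∩ B κ) := by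
    refine measure_mono_ae ?_
    filter_upwards [hN, hgood] with ω h1 h2 h3
    refine Set.mem_iUnion.2 ⟨⟨(G ω).canon, size_mapTimes_le.trans h1⟩, rfl, ?_⟩
    by_contra h4
    exact h3 (h2 _ h4)
  have hAm : ∀ κ, MeasurableSet (A κ) := fun κ =>
    hY.measurable_schedule (measurableSet_canon_eq κ.1)
  have hAB : ∀ κ, P (A κ ∩ B κ) ≤ P (A κ) * ε := by
    intro κ
    rw [hY.indep_schedule.measure_inter_preimage_eq_mul _ _ (measurableSet_canon_eq κ.1)
      (measurableSet_eval_eq_zero _)]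
    gcongr
    refine (measure_eval_eq_zero_le P Y hY.uniform hY.indep _ (hp κ.1)).trans ?_
    rw [hε]
    gcongr
    exact (hdeg κ.1).trans (Nat.pow_le_pow_left κ.2 3)
  have hdisj : Pairwise (Function.onFun Disjoint A) := by
    intro κ κ' hne
    refine Set.disjoint_left.2 fun ω h1 h2 => hne (Subtype.ext ?_)
    exact h1.symm.trans h2
  calc P {ω | ¬ good (G ω) (Y ω)} ≤ P (⋃ κ, A κ ∩ B κ) := hsub
    _ ≤ ∑' κ, P (A κ ∩ B κ) := measure_iUnion_le _
    _ ≤ ∑' κ, P (A κ) * ε := ENNReal.tsum_le_tsum hAB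
    _ = P (⋃ κ, A κ) * ε := by rw [ENNReal.tsum_mul_right, measure_iUnion hdisj hAm]
    _ ≤ 1 * ε := by gcongr; exact prob_le_one
    _ = ε := one_mul _

/-- The bound on failure probabilities, for nonadaptive schedules of polynomial size. -/
theorem NonAdaptive.measureReal_not_le {Ω F ι : Type*} [Fintype V] [Field F] [Fintype F]
    [MeasurableSpace F] [MeasurableSingletonClass F] [MeasurableSpace Ω] {P : Measure Ω}
    [IsProbabilityMeasure P] {G : Ω → Schedule V T k} {Y : Ω → ι → F} (hY : NonAdaptive P G Y)
    {c d : ℕ} (hF : Fintype.card V ^ (3 * d + c) ≤ Fintype.card F)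
    (hN : ∀ᵐ ω ∂P, (G ω).size ≤ Fintype.card V ^ d) (good : Schedule V T k → (ι → F) → Prop)
    (hempty : IsEmpty V → ∀ S c, good S c)
    (p : Schedule V ℕ k → MvPolynomial ι F) (hp : ∀ κ, p κ ≠ 0)
    (hdeg : ∀ κ, (p κ).totalDegree ≤ κ.size ^ 3)
    (hgood : ∀ᵐ ω ∂P, ∀ c, MvPolynomial.eval c (p (G ω).canon) ≠ 0 → good (G ω) c) :
    P.real {ω | ¬ good (G ω) (Y ω)} ≤ 1 / (Fintype.card V : ℝ) ^ c := by
  rcases isEmpty_or_nonempty V with hV | hV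
  -- Without nodes the right-hand side is `0` for `c > 0`, so failure must be impossible.
  · have : {ω | ¬ good (G ω) (Y ω)} = ∅ := by
      ext ω
      simp [hempty hV]
    rw [this, measureReal_empty]
    positivity
  · have hle := hY.measure_not_le hN good p hp hdeg hgood
    have hV0 : 0 < (Fintype.card V : ℝ) := by exact_mod_cast Fintype.card_pos
    have hF0 : 0 < (Fintype.card F : ℝ) := by exact_mod_cast Fintype.card_pos
    have hF' : (Fintype.card V : ℝ) ^ (3 * d + c) ≤ Fintype.card F := by exact_mod_cast hF
    have hfin : (((Fintype.card V ^ d) ^ 3 : ℕ) : ENNReal) / Fintype.card F ≠ ⊤ :=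
      ENNReal.div_ne_top (ENNReal.natCast_ne_top _) (by simp)
    refine (ENNReal.toReal_mono hfin hle).trans ?_
    rw [ENNReal.toReal_div, ENNReal.toReal_natCast, ENNReal.toReal_natCast,
      div_le_div_iff₀ hF0 (by positivity), one_mul]
    push_cast
    rw [← pow_mul, ← pow_add, mul_comm d 3]
    exact hF'

theorem deliversMax_of_isEmpty [IsEmpty V] {F Pkt : Type*} [Fintype F] [Nonempty F] {l : ℕ}
    [Nonempty Pkt] (S : Schedule V T k) (μ : ℕ∞) (A : S.Protocol Slot Pkt)
    (enc : (Fin k → Fin l → F) → Fin k → Pkt) : S.DeliversMax μ A enc :=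
  fun x => isEmptyElim x.1

/-! ### The three coding protocols -/

theorem step_congr {Pkt : Type*} (S : Schedule V T k) (A B : S.Protocol Slot Pkt)
    (orig : Fin k → Pkt)
    (hstore : ∀ σ x, A.store x (σ.mem x.1) (S.arrivals orig σ x) =
      B.store x (σ.mem x.1) (S.arrivals orig σ x))
    (hsend : ∀ σ e, A.send e (σ.mem (S.tail e).1) (S.arrivals orig σ (S.tail e)) =
      B.send e (σ.mem (S.tail e).1) (S.arrivals orig σ (S.tail e))) :
    S.step A orig = S.step B orig := by
  funext σ t
  simp only [step, hsend]
  congr 1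
  funext v
  rw [hstore σ (v, t)]

/-- If the polynomial coding `a` of a schedule specializes to the coding `b` for every choice of the
coefficients, up to renaming of times, then ranks of `b` are maximal outside of zeros. -/
theorem minCut_le_rank_of_eval_ne_zero [Fintype Slot] {F ι : Type*} [Field F] (K : Type*) [Field K]
    [Algebra F K] (S : Schedule V T k) (μ : ℕ∞) (a : S.canon.Coding Slot (MvPolynomial ι F))
    (bK : (ι → K) → S.Coding Slot K) (bF : (ι → F) → S.Coding Slot F)
    (hK : ∀ c, ∀ x ∈ S.copies, (bK c).vec x =
      (a.map (MvPolynomial.aeval c : _ →ₐ[F] K).toRingHom).vec (x.1, S.rank x.2))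
    (hF : ∀ c, ∀ x ∈ S.copies, (bF c).vec x = (a.map (MvPolynomial.eval c)).vec (x.1, S.rank x.2))
    (hgen : ∃ c, ∀ x ∈ S.copies, (S.infoFlowGraph μ).minCut none (some x) ≤ (bK c).rank x)
    {p : MvPolynomial ι F} {c : ι → F} (hc : MvPolynomial.eval c p ≠ 0)
    (hp : ∀ c : ι → F, MvPolynomial.eval c p ≠ 0 → ∀ x ∈ S.canon.copies, ∀ c₀ : ι → K,
        (a.map (MvPolynomial.aeval c₀ : _ →ₐ[F] K).toRingHom).rank x ≤
          (a.map (MvPolynomial.eval c)).rank x) :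
    ∀ x ∈ S.copies, (S.infoFlowGraph μ).minCut none (some x) ≤ (bF c).rank x := by
  intro x hx
  obtain ⟨c₀, h₀⟩ := hgen
  refine (h₀ x hx).trans (Nat.cast_le.2 ?_)
  have h1 := hp c hc (x.1, S.rank x.2) (mem_copies_mapTimes_of_mem hx) c₀
  have eK : (bK c₀).rank x =
      (a.map (MvPolynomial.aeval c₀ : _ →ₐ[F] K).toRingHom).rank (x.1, S.rank x.2) :=
    congrArg (fun v => Module.finrank K (Submodule.span K (Set.range v))) (hK c₀ x hx)
  have eF : (bF c).rank x = (a.map (MvPolynomial.eval c)).rank (x.1, S.rank x.2) :=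
    congrArg (fun v => Module.finrank F (Submodule.span F (Set.range v))) (hF c x hx)
  rw [eK, eF]
  exact h1

/-! ### Compatibility of the codings with renumbered times and with evaluation of the coefficients
-/

theorem rank_canon (S : Schedule V T k) {x : V × T} (hx : x ∈ S.copies) :
    S.canon.rank (S.rank x.2) = S.rank x.2 :=
  rank_mapTimes (h := S.strictMonoOn_rank) (S.snd_mem_times hx)

/-- Coins are indexed by ranks of event times rather than by times, so the same family drives `S`
and `S.canon`. -/
theorem recombCoding_vec_canon {R : Type*} [Semiring R] (S : Schedule V T k) (μ : ℕ)
    (c : RecombCoin V k μ → R) : ∀ x ∈ S.copies,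
      (S.recombCoding μ c).vec x = (S.canon.recombCoding μ c).vec (x.1, S.rank x.2) :=
  (S.recombCoding μ c).vec_mapTimes (S.canon.recombCoding μ c)
    (fun x hx j o => by
      change c (Sum.inl (x.1, S.canon.rank (S.rank x.2), j), _) = _
      rw [S.rank_canon hx]
      rfl)
    (fun _ _ => rfl)

theorem accCoding_vec_canon {R : Type*} [Semiring R] (S : Schedule V T k) (μ : ℕ)
    (c : AccCoin V k μ → R) : ∀ x ∈ S.copies,
      (S.accCoding μ c).vec x = (S.canon.accCoding μ c).vec (x.1, S.rank x.2) :=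
  (S.accCoding μ c).vec_mapTimes (S.canon.accCoding μ c)
    (fun x hx j o => by
      cases o with
      | inl i => rfl
      | inr p =>
        change c (Sum.inl ((x.1, S.canon.rank (S.rank x.2), j), _)) = _
        rw [S.rank_canon hx]
        rfl)
    (fun _ _ => rfl)

theorem pncCoding_vec_canon {R : Type*} [Semiring R] (S : Schedule V T k)
    (c : PncCoin k → R) : ∀ x ∈ S.copies,
      (S.pncCoding c).vec x = (S.canon.pncCoding c).vec (x.1, S.rank x.2) := by
  classical
  have hh : ∀ {x : V × T} (_ : x ∈ S.copies) (p : S.Label),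
      (x.1, S.rank x.2) ∈ S.canon.heads p ↔ x ∈ S.heads p := fun hx p =>
    mem_heads_mapTimes_iff hx
  refine (S.pncCoding c).vec_mapTimes (S.canon.pncCoding c) (fun x hx j o => ?_) (fun e o => ?_)
  · rcases o with p | p
    · exact @if_congr _ _ _ (_) (_) _ _ _ _ (and_congr_right fun _ => not_congr (hh hx j)) rfl rfl
    · exact @if_congr _ _ _ (_) (_) _ _ _ _ (and_congr_right fun _ => hh hx j) rfl rfl
  · rcases o with p | p
    · exact if_congr (hh (S.tail_mem_copies e) p) rfl rfl
    · exact if_congr (hh (S.tail_mem_copies e) p) rfl rfl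

theorem accCoding_map {R R' : Type*} [Semiring R] [Semiring R'] (S : Schedule V T k) (μ : ℕ)
    (c : AccCoin V k μ → R) (σ : R →+* R') :
    (S.accCoding μ c).map σ = S.accCoding μ fun i => σ (c i) := by
  simp only [accCoding, Coding.map, Coding.mk.injEq]
  constructor
  · funext x i o
    rcases o with j | p
    · simp only [Sum.elim_inl]
      split_ifs <;> simp
    · rfl
  · funext e o
    rcases o with j | p
    · rfl
    · simp

theorem pncCoding_map {R R' : Type*} [Semiring R] [Semiring R'] (S : Schedule V T k)
    (c : PncCoin k → R) (σ : R →+* R') :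
    (S.pncCoding c).map σ = S.pncCoding fun i => σ (c i) := by
  simp only [pncCoding, Coding.map, Coding.mk.injEq]
  constructor
  · funext x i o
    rcases o with p | p <;> simp only [Sum.elim_inl, Sum.elim_inr] <;> split_ifs <;> simp
  · funext e o
    rcases o with p | p <;> simp only [Sum.elim_inl, Sum.elim_inr] <;> split_ifs <;> simp

theorem aeval_comp_X {F K ι : Type*} [Field F] [Field K] [Algebra F K] (c : ι → K) :
    (fun i => (MvPolynomial.aeval c : MvPolynomial ι F →ₐ[F] K).toRingHom (MvPolynomial.X i)) = c :=
  funext fun i => MvPolynomial.aeval_X c i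

theorem eval_comp_X {F ι : Type*} [Field F] (c : ι → F) :
    (fun i => MvPolynomial.eval c (MvPolynomial.X i)) = c :=
  funext fun i => MvPolynomial.eval_X i

/-- The cells of the recombinator and the accumulator, as cells of a node with memory `μ`. -/
def cellEmbedding (μ : ℕ) : Fin μ ↪ {i : ℕ // (i : ℕ∞) < (μ : ℕ∞)} where
  toFun i := ⟨i.1, by exact_mod_cast i.2⟩
  inj' i j h := Fin.ext (congrArg Subtype.val h)

section Failure

variable {Ω F : Type*} [Fintype V] [Field F] [Fintype F]
    [MeasurableSpace F] [MeasurableSingletonClass F] [MeasurableSpace Ω] {P : Measure Ω}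
    [IsProbabilityMeasure P] {G : Ω → Schedule V T k} {c d l : ℕ}

/-- The coding with the variables as coefficients specializes to the generic coding over an infinite
field and to the actual one over `F`. The algebraic closure only serves to make the field infinite.
-/
theorem pnc_failure_le (hl : 0 < l) (hF : Fintype.card V ^ (3 * d + c) ≤ Fintype.card F)
    (hN : ∀ᵐ ω ∂P, (G ω).size ≤ Fintype.card V ^ d) {Y : Ω → PncCoin k → F}
    (hY : NonAdaptive P G Y) :
    P.real {ω | ¬ (G ω).DeliversMax ⊤ ((G ω).pnc (Y ω)) (withHeader (F := F) (l := l))} ≤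
      1 / (Fintype.card V : ℝ) ^ c := by
  classical
  let K := AlgebraicClosure F
  choose p hp0 hpd hp using fun κ : Schedule V ℕ k =>
    (κ.pncCoding (MvPolynomial.X : PncCoin k → MvPolynomial (PncCoin k) F)).exists_polynomial K
      (fun x j o => by
        rcases o with p | p <;> simp only [pncCoding, Sum.elim_inl, Sum.elim_inr] <;>
          split_ifs <;> simp)
      (fun e o => by
        rcases o with p | p <;> simp only [pncCoding, Sum.elim_inl, Sum.elim_inr] <;>
          split_ifs <;> simp)
  refine hY.measureReal_not_le hF hN
    (fun S c => S.DeliversMax ⊤ (S.pnc c) (withHeader (F := F) (l := l)))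
    (fun _ S c => deliversMax_of_isEmpty S _ _ _) p hp0 hpd
    (Filter.Eventually.of_forall fun ω c hc => ?_)
  set S := G ω
  -- PNC has one cell per label; enumerating the labels places these cells in the unlimited memory
  -- `ℕ`.
  obtain ⟨N, ⟨e⟩⟩ := Finite.exists_equiv_fin S.Label
  refine S.deliversMax_of_minCut_le_rank hl ⊤ _ (S.pncCoding c) rfl (fun orig => ?_)
    ⟨fun q => ⟨(e q).val, by simp⟩, fun q q' h => e.injective (Fin.ext (congrArg Subtype.val h))⟩ ?_
  · refine S.step_congr _ _ _ (fun σ x => ?_) (fun σ f => ?_)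
    · funext q
      have hsingle : ∀ (Q : Prop) [Decidable Q] [∀ q', Decidable (q' = q ∧ Q)]
          (f : S.Label → CodedPkt F k l),
          ∑ q', (if q' = q ∧ Q then (1 : F) else 0) • f q' = if Q then f q else 0 := by
        intro Q _ _ f
        rw [Finset.sum_eq_single q (fun q' _ hne => by simp [hne]) (by simp)]
        split_ifs <;> simp_all
      simp only [pnc, Coding.protocol, pncCoding, Coding.inputs, arrivals]
      rw [Fintype.sum_sum_type (α₁ := S.Label) (α₂ := S.Label)]
      simp only [Sum.elim_inl, Sum.elim_inr, hsingle]
      by_cases hq : x ∈ S.heads q <;> simp [hq]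
    · simp only [pnc, Coding.protocol, pncCoding, Coding.inputs, arrivals]
      rw [Fintype.sum_sum_type (α₁ := S.Label) (α₂ := S.Label)]
      simp only [Sum.elim_inl, Sum.elim_inr, ← Finset.sum_add_distrib]
      refine Finset.sum_congr rfl fun q _ => ?_
      by_cases hq : S.tail f ∈ S.heads q <;> simp [hq]
  · refine S.minCut_le_rank_of_eval_ne_zero (Slot := S.Label) K ⊤ (S.canon.pncCoding MvPolynomial.X)
      (fun c => S.pncCoding c) (fun c => S.pncCoding c) (fun c x hx => ?_) (fun c x hx => ?_)
      S.exists_pncCoding_rank hc (hp S.canon)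
    · have h := S.canon.pncCoding_map
        (MvPolynomial.X : PncCoin k → MvPolynomial (PncCoin k) F)
        (MvPolynomial.aeval c : _ →ₐ[F] K).toRingHom
      rw [aeval_comp_X] at h
      exact (S.pncCoding_vec_canon c x hx).trans
        (congrArg (fun b : S.canon.Coding S.canon.Label K => b.vec (x.1, S.rank x.2)) h.symm)
    · have h := S.canon.pncCoding_map
        (MvPolynomial.X : PncCoin k → MvPolynomial (PncCoin k) F) (MvPolynomial.eval c)
      rw [eval_comp_X] at h
      exact (S.pncCoding_vec_canon c x hx).trans
        (congrArg (fun b : S.canon.Coding S.canon.Label F => b.vec (x.1, S.rank x.2)) h.symm)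

theorem recombinator_failure_le (hl : 0 < l) (hF : Fintype.card V ^ (3 * d + c) ≤ Fintype.card F)
    (hN : ∀ᵐ ω ∂P, (G ω).size ≤ Fintype.card V ^ d) {μ : ℕ} {Y : Ω → RecombCoin V k μ → F}
    (hY : NonAdaptive P G Y) :
    P.real {ω | ¬ (G ω).DeliversMax (μ : ℕ∞) ((G ω).recombinator μ (Y ω))
      (withHeader (F := F) (l := l))} ≤ 1 / (Fintype.card V : ℝ) ^ c := by
  classical
  let K := AlgebraicClosure F
  choose p hp0 hpd hp using fun κ : Schedule V ℕ k =>
    (κ.recombCoding μ (MvPolynomial.X : RecombCoin V k μ →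
      MvPolynomial (RecombCoin V k μ) F)).exists_polynomial K
      (fun x j o => (MvPolynomial.totalDegree_X _).le)
      (fun e o => (MvPolynomial.totalDegree_X _).le)
  refine hY.measureReal_not_le hF hN
    (fun S c => S.DeliversMax (μ : ℕ∞) (S.recombinator μ c) (withHeader (F := F) (l := l)))
    (fun _ S c => deliversMax_of_isEmpty S _ _ _) p hp0 hpd
    (Filter.Eventually.of_forall fun ω c hc => ?_)
  set S := G ω
  refine S.deliversMax_of_minCut_le_rank hl μ _ (S.recombCoding μ c) rfl (fun orig => ?_)
    (cellEmbedding μ) ?_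
  · refine S.step_congr _ _ _ (fun σ x => ?_) (fun σ f => ?_)
    · funext i
      simp only [recombinator, Coding.protocol, recombCoding, Coding.inputs]
      rw [Fintype.sum_sum_type (α₁ := Fin μ) (α₂ := S.Label)]
      rfl
    · simp only [recombinator, Coding.protocol, recombCoding, Coding.inputs]
      rw [Fintype.sum_sum_type (α₁ := Fin μ) (α₂ := S.Label)]
      rfl
  · refine S.minCut_le_rank_of_eval_ne_zero K μ (S.canon.recombCoding μ MvPolynomial.X)
      (fun c => S.recombCoding μ c) (fun c => S.recombCoding μ c) (fun c x hx => ?_)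
      (fun c x hx => ?_) (S.exists_recombCoding_rank μ) hc (hp S.canon)
    · have h : (S.canon.recombCoding μ (MvPolynomial.X : RecombCoin V k μ →
          MvPolynomial (RecombCoin V k μ) F)).map (MvPolynomial.aeval c : _ →ₐ[F] K).toRingHom =
          S.canon.recombCoding μ c :=
        congrArg (S.canon.recombCoding μ) (aeval_comp_X c)
      rw [h]
      exact S.recombCoding_vec_canon μ c x hx
    · have h : (S.canon.recombCoding μ (MvPolynomial.X : RecombCoin V k μ →
          MvPolynomial (RecombCoin V k μ) F)).map (MvPolynomial.eval c) =
          S.canon.recombCoding μ c :=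
        congrArg (S.canon.recombCoding μ) (eval_comp_X c)
      rw [h]
      exact S.recombCoding_vec_canon μ c x hx

theorem accumulator_failure_le (hl : 0 < l) (hF : Fintype.card V ^ (3 * d + c) ≤ Fintype.card F)
    (hN : ∀ᵐ ω ∂P, (G ω).size ≤ Fintype.card V ^ d) {μ : ℕ} {Y : Ω → AccCoin V k μ → F}
    (hY : NonAdaptive P G Y) (hG : ∀ᵐ ω ∂P, (G ω).HalfDuplex) :
    P.real {ω | ¬ (G ω).DeliversMax (μ : ℕ∞) ((G ω).accumulator μ (Y ω))
      (withHeader (F := F) (l := l))} ≤ 1 / (Fintype.card V : ℝ) ^ c := by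
  classical
  let K := AlgebraicClosure F
  choose p hp0 hpd hp using fun κ : Schedule V ℕ k =>
    (κ.accCoding μ (MvPolynomial.X : AccCoin V k μ →
      MvPolynomial (AccCoin V k μ) F)).exists_polynomial K
      (fun x j o => by
        rcases o with i | p
        · simp only [accCoding, Sum.elim_inl]
          split_ifs <;> simp
        · exact (MvPolynomial.totalDegree_X _).le)
      (fun e o => by
        rcases o with i | p
        · exact (MvPolynomial.totalDegree_X _).le
        · simp [accCoding])
  refine hY.measureReal_not_le hF hN
    (fun S c => S.DeliversMax (μ : ℕ∞) (S.accumulator μ c) (withHeader (F := F) (l := l)))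
    (fun _ S c => deliversMax_of_isEmpty S _ _ _) p hp0 hpd
    (hG.mono fun ω hS c hc => ?_)
  set S := G ω
  refine S.deliversMax_of_minCut_le_rank hl μ _ (S.accCoding μ c) rfl (fun orig => ?_)
    (cellEmbedding μ) ?_
  · refine S.step_congr _ _ _ (fun σ x => ?_) (fun σ f => ?_)
    · funext i
      simp only [accumulator, Coding.protocol, accCoding, Coding.inputs]
      rw [Fintype.sum_sum_type (α₁ := Fin μ) (α₂ := S.Label)]
      simp [ite_smul]
    · simp only [accumulator, Coding.protocol, accCoding, Coding.inputs]
      rw [Fintype.sum_sum_type (α₁ := Fin μ) (α₂ := S.Label)]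
      simp
  · refine S.minCut_le_rank_of_eval_ne_zero K μ (S.canon.accCoding μ MvPolynomial.X)
      (fun c => S.accCoding μ c) (fun c => S.accCoding μ c) (fun c x hx => ?_)
      (fun c x hx => ?_) (S.exists_accCoding_rank hS μ) hc (hp S.canon)
    · rw [accCoding_map, aeval_comp_X]
      exact S.accCoding_vec_canon μ c x hx
    · rw [accCoding_map, eval_comp_X]
      exact S.accCoding_vec_canon μ c x hx

end Failure

end Schedule

end

/-- For all `c` and `d` there is `C` such that, on random schedules of size at most `n ^ d` between
`n` nodes which are independent of the coefficients, over every field with at least `n ^ C` elements,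
each of the three protocols fails with probability at most `n ^ (-c)`. -/
theorem theorem2 (c d : ℕ) :
    ∃ C : ℕ, ∀ (V T Ω F : Type*) [Fintype V] [LinearOrder T]
      [Field F] [Fintype F] [MeasurableSpace F] [MeasurableSingletonClass F]
      [MeasurableSpace Ω] (P : MeasureTheory.Measure Ω) [MeasureTheory.IsProbabilityMeasure P]
      (k l : ℕ) (G : Ω → Schedule V T k),
      0 < l →
      Fintype.card V ^ C ≤ Fintype.card F →
      (∀ᵐ ω ∂P, (G ω).size ≤ Fintype.card V ^ d) →
      (∀ Y : Ω → Schedule.PncCoin k → F, Schedule.NonAdaptive P G Y →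
        P.real {ω | ¬ (G ω).DeliversMax ⊤ ((G ω).pnc (Y ω))
            (Schedule.withHeader (F := F) (l := l))}
          ≤ 1 / (Fintype.card V : ℝ) ^ c) ∧
      (∀ (μ : ℕ) (Y : Ω → Schedule.RecombCoin V k μ → F), Schedule.NonAdaptive P G Y →
        P.real {ω | ¬ (G ω).DeliversMax (μ : ℕ∞) ((G ω).recombinator μ (Y ω))
            (Schedule.withHeader (F := F) (l := l))}
          ≤ 1 / (Fintype.card V : ℝ) ^ c) ∧
      (∀ (μ : ℕ) (Y : Ω → Schedule.AccCoin V k μ → F), Schedule.NonAdaptive P G Y →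
        (∀ᵐ ω ∂P, (G ω).HalfDuplex) →
        P.real {ω | ¬ (G ω).DeliversMax (μ : ℕ∞) ((G ω).accumulator μ (Y ω))
            (Schedule.withHeader (F := F) (l := l))}
          ≤ 1 / (Fintype.card V : ℝ) ^ c) := by
  -- The degree is at most the cube of the size, hence at most `n ^ (3 * d)`; the remaining factor
  -- `n ^ c` is the failure probability aimed at.
  refine ⟨3 * d + c, ?_⟩
  intro V T Ω F _ _ _ _ _ _ _ P _ k l G hl hF hN
  exact ⟨fun Y hY => Schedule.pnc_failure_le hl hF hN hY,
    fun μ Y hY => Schedule.recombinator_failure_le hl hF hN hY,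
    fun μ Y hY hG => Schedule.accumulator_failure_le hl hF hN hY hG⟩
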